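/- Let $\mathbb{K}$ be a field of characteristic zero, and let $(A,\cdot,\{-,-\})$ be a finite-dimensional (not necessarily commutative) Poisson algebra over $\mathbb{K}$: $(A,\cdot)$ is a unital associative $\mathbb{K}$-algebra of finite dimension, $(A,\{-,-\})$ is a Lie algebra over $\mathbb{K}$, and $\{a,bc\}=\{a,b\}c+b\{a,c\}$ for all $a,b,c\in A$. Let $A^e=A\otimes_{\mathbb{K}} A^{\mathrm{op}}$, let $U(A)$ be the universal enveloping algebra of the Lie algebra $(A,\{-,-\})$, acting on $A$ and on $A^e$ through the Lie bracket, and let $\mathcal{Q}(A)=A^e\# U(A)$ be the smash product. The algebra $A$ is a left $\mathcal{Q}(A)$-module by $(a\otimes b'\# h)\,m=a\,h(m)\,b$ and a left $A^e$-module by $(a\otimes b')\,m=amb$. Let $$HQ^*(A)=\bigoplus_{n\ge 0}\mathrm{Ext}^n_{\mathcal{Q}(A)}(A,A),\qquad HH^*(A)=\bigoplus_{n\ge 0}\mathrm{Ext}^n_{A^e}(A,A)$$ be the quasi-Poisson cohomology algebra and the Hochschild cohomology algebra of $A$, with the Yoneda product. If the Lie bracket is trivial, i.e. $\{a,b\}=0$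 for all $a,b\in A$, then there is an isomorphism of graded $\mathbb{K}$-algebras $$HQ^*(A)\;\cong\; HH^*(A)\otimes \wedge A,$$ where $\wedge A=\bigoplus_{j\ge 0}\wedge^j A$ is the exterior algebra of the vector space $A$, graded by $\deg \wedge^jA=j$, and $\otimes$ is the graded tensor product over $\mathbb{K}$: its product is $(x\otimes\omega)(y\otimes\eta)=(-1)^{\deg\omega\,\deg y}\,xy\otimes\omega\eta$ on homogeneous elements, and its degree $n$ part is $\bigoplus_{i+j=n}HH^i(A)\otimes\wedge^jA$. -/

import Mathlib

open CategoryTheory CategoryTheory.Abelian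
open scoped TensorProduct DirectSum

universe u

noncomputable section

attribute [local instance 100] LieRing.ofAssociativeRing

/-! ### The Yoneda algebra `⨁ n, Extⁿ(X, X)` -/

namespace YonedaExt

variable {C : Type*} [Category C] [Abelian C] [HasExt.{u} C] (X : C)

theorem mk_comp_eq {X : C} {a b c c' : ℕ} (α : Ext X X a) (β : Ext X X b) (h : a + b = c)
    (h' : a + b = c') :
    (GradedMonoid.mk c (α.comp β h) : GradedMonoid fun n : ℕ => Ext X X n) =
      GradedMonoid.mk c' (α.comp β h') := by
  subst h; subst h'; rfl

instance instGOne : GradedMonoid.GOne (fun n : ℕ => Ext X X n) where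
  one := Ext.mk₀ (𝟙 X)

/-- The Yoneda product, in the order of composition of maps: `α * β` is `α ∘ β`
(Mathlib's `Ext.comp` is written in the diagrammatic order). -/
instance instGMul : GradedMonoid.GMul (fun n : ℕ => Ext X X n) where
  mul {i j} α β := β.comp α (add_comm j i)

instance instGRing : DirectSum.GRing (fun n : ℕ => Ext X X n) where
  mul_zero α := Ext.zero_comp X _ α _ _
  zero_mul α := Ext.comp_zero α X _ _ _
  mul_add α β γ := Ext.add_comp β γ α _
  add_mul α β γ := Ext.comp_add γ α β _
  one_mul := by
    rintro ⟨n, α⟩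
    refine (mk_comp_eq α (Ext.mk₀ (𝟙 X)) _ (add_zero n)).trans ?_
    rw [Ext.comp_mk₀_id]; rfl
  mul_one := by
    rintro ⟨n, α⟩
    refine (mk_comp_eq (Ext.mk₀ (𝟙 X)) α _ (zero_add n)).trans ?_
    rw [Ext.mk₀_id_comp]; rfl
  mul_assoc := by
    rintro ⟨a, α⟩ ⟨b, β⟩ ⟨c, γ⟩
    have h : (γ.comp (β.comp α (add_comm b a)) (by omega) : Ext X X (a + b + c)) =
        (γ.comp β (add_comm c b)).comp α (by omega) :=
      (Ext.comp_assoc γ β α (add_comm c b) (add_comm b a) (by omega)).symm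
    refine (congrArg (GradedMonoid.mk (A := fun n : ℕ => Ext X X n) (a + b + c)) h).trans ?_
    exact mk_comp_eq _ _ _ _
  natCast n := n • Ext.mk₀ (𝟙 X)
  natCast_zero := zero_smul ℕ _
  natCast_succ n := succ_nsmul _ n
  intCast n := n • Ext.mk₀ (𝟙 X)
  intCast_ofNat n := natCast_zsmul _ n
  intCast_negSucc_ofNat n := negSucc_zsmul _ n

variable (K : Type*) [CommRing K] [Linear K C]

instance instGAlgebra : DirectSum.GAlgebra K (fun n : ℕ => Ext X X n) where
  toFun :=
    { toFun := fun r => r • Ext.mk₀ (𝟙 X)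
      map_zero' := zero_smul K _
      map_add' := fun r s => add_smul r s _ }
  map_one := one_smul K _
  map_mul r s := by
    refine Eq.trans ?_ (mk_comp_eq (s • Ext.mk₀ (𝟙 X)) (r • Ext.mk₀ (𝟙 X)) (add_zero 0) _)
    simp [mul_smul]
  commutes := by
    rintro r ⟨n, α⟩
    refine (mk_comp_eq α (r • Ext.mk₀ (𝟙 X)) _ (add_zero n)).trans
      (Eq.trans ?_ (mk_comp_eq (r • Ext.mk₀ (𝟙 X)) α (zero_add n) _))
    simp
  smul_def := by
    rintro r ⟨n, α⟩
    refine Eq.trans ?_ (mk_comp_eq α (r • Ext.mk₀ (𝟙 X)) (add_zero n) _)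
    simp
    rfl

end YonedaExt

/-- The Yoneda algebra `Ext^*(X, X) = ⨁ n, Extⁿ(X, X)`. -/
abbrev YonedaAlgebra {C : Type*} [Category C] [Abelian C] [HasExt.{u} C] (X : C) : Type u :=
  ⨁ n : ℕ, Ext X X n

/-- The homogeneous part `Extⁿ(X, X)` of the Yoneda algebra. -/
def yonedaGrading (K : Type*) [CommRing K] {C : Type*} [Category C] [Abelian C] [HasExt.{u} C]
    [Linear K C] (X : C) (n : ℕ) : Submodule K (YonedaAlgebra X) :=
  LinearMap.range (DirectSum.lof K ℕ (fun n : ℕ => Ext X X n) n)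

section Grading

variable (K : Type*) [CommRing K] {C : Type*} [Category C] [Abelian C] [HasExt.{u} C]
  [Linear K C] (X : C)

instance yonedaGrading_gradedMonoid : SetLike.GradedMonoid (yonedaGrading K X) where
  one_mem := ⟨GradedMonoid.GOne.one, rfl⟩
  mul_mem := by
    rintro i j _ _ ⟨α, rfl⟩ ⟨β, rfl⟩
    exact ⟨GradedMonoid.GMul.mul α β, (DirectSum.of_mul_of (A := fun n : ℕ => Ext X X n) α β).symm⟩

instance yonedaGrading_decomposition : DirectSum.Decomposition (yonedaGrading K X) :=
  DirectSum.Decomposition.ofLinearMap _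
    (DirectSum.toModule K ℕ _ fun n =>
      (DirectSum.lof K ℕ (fun n => yonedaGrading K X n) n) ∘ₗ
        (DirectSum.lof K ℕ (fun n : ℕ => Ext X X n) n).codRestrict (yonedaGrading K X n)
          (fun α => ⟨α, rfl⟩))
    (by
      apply DirectSum.linearMap_ext
      intro n
      ext α : 1
      simp only [LinearMap.comp_apply, DirectSum.toModule_lof, LinearMap.id_apply,
        DirectSum.coeLinearMap_lof]
      rfl)
    (by
      apply DirectSum.linearMap_ext
      rintro n
      ext ⟨_, α, rfl⟩ : 1
      simp [DirectSum.toModule_lof]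
      rfl)

instance yonedaGrading_gradedAlgebra : GradedAlgebra (yonedaGrading K X) where

end Grading

/-- The degree `n` part of the graded tensor product of two graded algebras. -/
def gradedTensorDegree {R A B : Type*} [CommRing R] [Ring A] [Ring B] [Algebra R A] [Algebra R B]
    (𝒜 : ℕ → Submodule R A) (ℬ : ℕ → Submodule R B) [GradedAlgebra 𝒜] [GradedAlgebra ℬ] (n : ℕ) :
    Submodule R (𝒜 ᵍ⊗[R] ℬ) :=
  Submodule.span R {t | ∃ i j : ℕ, i + j = n ∧ ∃ a ∈ 𝒜 i, ∃ b ∈ ℬ j, t = a ᵍ⊗ₜ[R] b}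

/-! ### Smash products with universal enveloping algebras -/

/-- An action of the Lie algebra `L` on the associative algebra `B` by derivations; equivalently,
a structure of `U(L)`-module algebra on `B`. -/
structure LieDerivationAction (K L B : Type*) [CommRing K] [LieRing L] [LieAlgebra K L] [Ring B]
    [Algebra K B] extends L →ₗ⁅K⁆ Module.End K B where
  leibniz' : ∀ (x : L) (b c : B), toFun x (b * c) = toFun x b * c + b * toFun x c

namespace UniversalEnvelopingAlgebra

variable (K L : Type*) [CommRing K] [LieRing L] [LieAlgebra K L]

/-- The coproduct of `U(L)`: the algebra map with `x ↦ x ⊗ 1 + 1 ⊗ x` for `x ∈ L`. -/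
def coproduct : UniversalEnvelopingAlgebra K L →ₐ[K]
    UniversalEnvelopingAlgebra K L ⊗[K] UniversalEnvelopingAlgebra K L :=
  lift K
    { toFun := fun x => ι K x ⊗ₜ 1 + 1 ⊗ₜ ι K x
      map_add' := fun x y => by simp only [map_add, TensorProduct.add_tmul, TensorProduct.tmul_add]; abel
      map_smul' := fun r x => by
        simp only [map_smul, RingHom.id_apply, smul_add, TensorProduct.smul_tmul',
          TensorProduct.tmul_smul]
      map_lie' := fun {x y} => by
        simp only [LieHom.map_lie, LieRing.of_associative_ring_bracket, TensorProduct.sub_tmul,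
          TensorProduct.tmul_sub, add_mul, mul_add, Algebra.TensorProduct.tmul_mul_tmul, mul_one,
          one_mul]
        abel }

variable {K L}

theorem induct {P : UniversalEnvelopingAlgebra K L → Prop}
    (algebraMap : ∀ r, P (algebraMap K _ r)) (ι : ∀ x, P (ι K x))
    (mul : ∀ a b, P a → P b → P (a * b)) (add : ∀ a b, P a → P b → P (a + b)) (h) : P h := by
  let S : Subalgebra K (UniversalEnvelopingAlgebra K L) :=
    { carrier := {a | P a}
      mul_mem' := fun {a b} => mul a b
      add_mem' := fun {a b} => add a b
      algebraMap_mem' := algebraMap }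
  let f : L →ₗ⁅K⁆ S :=
    { toFun := fun x => ⟨UniversalEnvelopingAlgebra.ι K x, ι x⟩
      map_add' := fun x y => Subtype.ext (map_add _ _ _)
      map_smul' := fun r x => Subtype.ext (map_smul _ _ _)
      map_lie' := fun {x y} => Subtype.ext (by
        simp [-ι_apply, LieRing.of_associative_ring_bracket]) }
  have h1 : S.val.comp (lift K f) = AlgHom.id K _ := by
    apply hom_ext
    ext x
    change ((lift K f (UniversalEnvelopingAlgebra.ι K x) : S) : UniversalEnvelopingAlgebra K L) = _
    rw [lift_ι_apply]
    rfl
  have h2 := DFunLike.congr_fun h1 h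
  change ((lift K f h : S) : UniversalEnvelopingAlgebra K L) = h at h2
  rw [← h2]
  exact (lift K f h).2

end UniversalEnvelopingAlgebra

/-- The smash product `B # U(L)`, with underlying module `B ⊗ U(L)`. -/
def SmashProduct {K L B : Type*} [CommRing K] [LieRing L] [LieAlgebra K L] [Ring B]
    [Algebra K B] (_δ : LieDerivationAction K L B) : Type _ :=
  B ⊗[K] UniversalEnvelopingAlgebra K L

namespace SmashProduct

open UniversalEnvelopingAlgebra

variable {K L B : Type*} [CommRing K] [LieRing L] [LieAlgebra K L] [Ring B] [Algebra K B]
  (δ : LieDerivationAction K L B)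

instance : AddCommGroup (SmashProduct δ) :=
  inferInstanceAs (AddCommGroup (B ⊗[K] UniversalEnvelopingAlgebra K L))

instance : Module K (SmashProduct δ) :=
  inferInstanceAs (Module K (B ⊗[K] UniversalEnvelopingAlgebra K L))

/-- The element `b # h`. -/
def mk (b : B) (h : UniversalEnvelopingAlgebra K L) : SmashProduct δ :=
  (b ⊗ₜ[K] h : B ⊗[K] UniversalEnvelopingAlgebra K L)

/-- The algebra map `U(L) → End(B ⊗ U(L))`, `h ↦ (c ⊗ k ↦ ∑ h₁(c) ⊗ h₂ k)`. -/
def diagonal : UniversalEnvelopingAlgebra K L →ₐ[K]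
    Module.End K (B ⊗[K] UniversalEnvelopingAlgebra K L) :=
  (Module.endTensorEndAlgHom.comp
    (Algebra.TensorProduct.map (lift K δ.toLieHom) (Algebra.lmul K _))).comp (coproduct K L)

/-- Left multiplication by an element of `B ⊗ U(L)`, determined by
`(b ⊗ h) · (c ⊗ k) = ∑ b h₁(c) ⊗ h₂ k`. -/
def leftMul : B ⊗[K] UniversalEnvelopingAlgebra K L →ₗ[K]
    Module.End K (B ⊗[K] UniversalEnvelopingAlgebra K L) :=
  TensorProduct.lift
    ((LinearMap.mul K (Module.End K (B ⊗[K] UniversalEnvelopingAlgebra K L))).compl₁₂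
      ((LinearMap.rTensorHom (UniversalEnvelopingAlgebra K L)) ∘ₗ LinearMap.mul K B)
      (diagonal δ).toLinearMap)

instance : Mul (SmashProduct δ) := ⟨fun p q => leftMul δ p q⟩

instance : One (SmashProduct δ) := ⟨mk δ 1 1⟩

theorem leftMul_tmul (b : B) (h : UniversalEnvelopingAlgebra K L)
    (q : B ⊗[K] UniversalEnvelopingAlgebra K L) :
    leftMul δ (b ⊗ₜ h) q = (LinearMap.mul K B b).rTensor _ (diagonal δ h q) := rfl

theorem diagonal_ι (x : L) (c : B) (k : UniversalEnvelopingAlgebra K L) :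
    diagonal δ (ι K x) (c ⊗ₜ k) = δ.toLieHom x c ⊗ₜ k + c ⊗ₜ (ι K x * k) := by
  have : coproduct K L (ι K x) = ι K x ⊗ₜ 1 + 1 ⊗ₜ ι K x := lift_ι_apply K _ x
  change Module.endTensorEndAlgHom ((Algebra.TensorProduct.map (lift K δ.toLieHom)
    (Algebra.lmul K _)) (coproduct K L (ι K x))) (c ⊗ₜ k) = _
  rw [this, map_add, Algebra.TensorProduct.map_tmul, Algebra.TensorProduct.map_tmul, map_one,
    map_one, lift_ι_apply, map_add, LinearMap.add_apply, Module.endTensorEndAlgHom_apply,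
    Module.endTensorEndAlgHom_apply]
  rfl

theorem leftMul_rTensor (b : B) (p : B ⊗[K] UniversalEnvelopingAlgebra K L) :
    leftMul δ ((LinearMap.mul K B b).rTensor _ p) =
      (LinearMap.mul K B b).rTensor _ * leftMul δ p := by
  induction p with
  | zero => simp
  | add p q hp hq => rw [map_add, map_add, hp, hq, map_add, mul_add]
  | tmul c k =>
    refine LinearMap.ext fun q => ?_
    simp only [LinearMap.rTensor_tmul, Module.End.mul_apply, leftMul_tmul]
    rw [← LinearMap.rTensor_comp_apply]
    congr 2
    ext d
    simp [mul_assoc]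

theorem leftMul_diagonal (h : UniversalEnvelopingAlgebra K L)
    (p : B ⊗[K] UniversalEnvelopingAlgebra K L) :
    leftMul δ (diagonal δ h p) = diagonal δ h * leftMul δ p := by
  induction h using UniversalEnvelopingAlgebra.induct generalizing p with
  | algebraMap r =>
    rw [AlgHom.commutes, Module.algebraMap_end_apply, map_smul, Algebra.smul_def]
  | mul a b ha hb => rw [map_mul, Module.End.mul_apply, ha, hb, mul_assoc]
  | add a b ha hb => rw [map_add, LinearMap.add_apply, map_add, ha, hb, add_mul]
  | ι x =>
    induction p with
    | zero => simp
    | add p q hp hq => rw [map_add, map_add, hp, hq, map_add, mul_add]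
    | tmul c k =>
      refine LinearMap.ext fun q => ?_
      rw [diagonal_ι, map_add, LinearMap.add_apply, Module.End.mul_apply, leftMul_tmul,
        leftMul_tmul, leftMul_tmul, map_mul, Module.End.mul_apply]
      induction diagonal δ k q with
      | zero => simp
      | add p q hp hq =>
        simp only [map_add] at hp hq ⊢
        rw [← hp, ← hq]; abel
      | tmul d l =>
        have := δ.leibniz' x c d
        simp only [LinearMap.rTensor_tmul, diagonal_ι, map_add, LinearMap.mul_apply_apply]
        rw [← add_assoc, ← TensorProduct.add_tmul]
        congr 2
        exact this.symm

theorem leftMul_leftMul (p q : B ⊗[K] UniversalEnvelopingAlgebra K L) :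
    leftMul δ (leftMul δ p q) = leftMul δ p * leftMul δ q := by
  induction p with
  | zero => simp
  | add p p' hp hp' => simp only [map_add, LinearMap.add_apply, hp, hp', add_mul]
  | tmul b h =>
    rw [leftMul_tmul, leftMul_rTensor, leftMul_diagonal, ← mul_assoc]
    rfl

theorem leftMul_one_left (p : B ⊗[K] UniversalEnvelopingAlgebra K L) :
    leftMul δ (1 ⊗ₜ 1) p = p := by
  rw [leftMul_tmul, map_one (diagonal δ), Module.End.one_apply]
  have : LinearMap.mul K B 1 = LinearMap.id := by ext; simp
  rw [this, LinearMap.rTensor_id]; rfl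

theorem diagonal_one_tmul (h k : UniversalEnvelopingAlgebra K L) :
    diagonal δ h (1 ⊗ₜ k) = 1 ⊗ₜ (h * k) := by
  induction h using UniversalEnvelopingAlgebra.induct generalizing k with
  | algebraMap r =>
    rw [AlgHom.commutes, Module.algebraMap_end_apply, ← Algebra.smul_def, TensorProduct.tmul_smul]
  | mul a b ha hb => rw [map_mul, Module.End.mul_apply, hb, ha, mul_assoc]
  | add a b ha hb => rw [map_add, LinearMap.add_apply, ha, hb, add_mul, TensorProduct.tmul_add]
  | ι x =>
    have h1 : δ.toLieHom x 1 = 0 := by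
      have : δ.toLieHom x (1 * 1) = δ.toLieHom x 1 * 1 + 1 * δ.toLieHom x 1 := δ.leibniz' x 1 1
      simpa using this
    rw [diagonal_ι, h1, TensorProduct.zero_tmul, zero_add]

theorem leftMul_one_right (p : B ⊗[K] UniversalEnvelopingAlgebra K L) :
    leftMul δ p (1 ⊗ₜ 1) = p := by
  induction p with
  | zero => simp
  | add p q hp hq => rw [map_add, LinearMap.add_apply, hp, hq]
  | tmul b h =>
    rw [leftMul_tmul, diagonal_one_tmul]
    simp

instance : Ring (SmashProduct δ) where
  left_distrib p q r := map_add (leftMul δ p) q r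
  right_distrib p q r := LinearMap.map_add₂ (leftMul δ) p q r
  zero_mul p := LinearMap.map_zero₂ (leftMul δ) p
  mul_zero p := map_zero (leftMul δ p)
  mul_assoc p q r := DFunLike.congr_fun (leftMul_leftMul δ p q) r
  one_mul p := leftMul_one_left δ p
  mul_one p := leftMul_one_right δ p
  neg_add_cancel := neg_add_cancel
  zsmul := (· • ·)
  zsmul_zero' := zero_zsmul
  zsmul_succ' := SubNegMonoid.zsmul_succ'
  zsmul_neg' := SubNegMonoid.zsmul_neg'

instance : Algebra K (SmashProduct δ) :=
  Algebra.ofModule (fun r p q => LinearMap.map_smul₂ (leftMul δ) r p q)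
    (fun r p q => map_smul (leftMul δ p) r q)

variable {δ}

/-- An algebra map `f` on `B` and a Lie algebra map `g` on `L` with `[g x, f b] = f (x(b))`
define the algebra map `b # h ↦ f b * g h` on `B # U(L)`. -/
def lift {E : Type*} [Ring E] [Algebra K E] (f : B →ₐ[K] E) (g : L →ₗ⁅K⁆ E)
    (hfg : ∀ x b, g x * f b = f (δ.toLieHom x b) + f b * g x) : SmashProduct δ →ₐ[K] E :=
  let φ : B ⊗[K] UniversalEnvelopingAlgebra K L →ₗ[K] E :=
    TensorProduct.lift ((LinearMap.mul K E).compl₁₂ f.toLinearMap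
      (UniversalEnvelopingAlgebra.lift K g).toLinearMap)
  have φ_tmul : ∀ b h, φ (b ⊗ₜ h) = f b * UniversalEnvelopingAlgebra.lift K g h :=
    fun _ _ => rfl
  have hB : ∀ b q, φ ((LinearMap.mul K B b).rTensor _ q) = f b * φ q := fun b q => by
    induction q with
    | zero => simp
    | add p q hp hq => simp only [map_add, hp, hq, mul_add]
    | tmul c k => simp [φ_tmul, mul_assoc]
  have hU : ∀ h q, φ (diagonal δ h q) = UniversalEnvelopingAlgebra.lift K g h * φ q := fun h => by
    induction h using UniversalEnvelopingAlgebra.induct with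
    | algebraMap r =>
      intro q
      rw [AlgHom.commutes, AlgHom.commutes, Module.algebraMap_end_apply, map_smul,
        Algebra.smul_def]
    | mul a b ha hb => intro q; rw [map_mul, map_mul, Module.End.mul_apply, ha, hb, mul_assoc]
    | add a b ha hb => intro q; rw [map_add, LinearMap.add_apply, map_add, ha, hb, map_add, add_mul]
    | ι x =>
      intro q
      induction q with
      | zero => simp
      | add p q hp hq => simp only [map_add, hp, hq, mul_add]
      | tmul c k =>
        rw [diagonal_ι, map_add, φ_tmul, φ_tmul, φ_tmul, map_mul,
          UniversalEnvelopingAlgebra.lift_ι_apply, ← mul_assoc, ← mul_assoc, ← add_mul, hfg]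
  have hmul : ∀ p q, φ (leftMul δ p q) = φ p * φ q := fun p q => by
    induction p with
    | zero => simp
    | add p p' hp hp' => rw [map_add, LinearMap.add_apply, map_add, hp, hp', map_add, add_mul]
    | tmul b h => rw [leftMul_tmul, hB, hU, φ_tmul, mul_assoc]
  AlgHom.ofLinearMap (A := SmashProduct δ) φ
    (by
      change φ (1 ⊗ₜ 1) = 1
      rw [φ_tmul, map_one, map_one, one_mul])
    hmul

theorem lift_mk {E : Type*} [Ring E] [Algebra K E] (f : B →ₐ[K] E) (g : L →ₗ⁅K⁆ E)
    (hfg : ∀ x b, g x * f b = f (δ.toLieHom x b) + f b * g x) (b : B)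
    (h : UniversalEnvelopingAlgebra K L) :
    lift f g hfg (mk δ b h) = f b * UniversalEnvelopingAlgebra.lift K g h := rfl

end SmashProduct

/-! ### Poisson algebras -/

/-- A (not necessarily commutative) Poisson algebra structure on the associative unital
`K`-algebra `A`. -/
class PoissonAlgebra (K A : Type*) [CommRing K] [Ring A] [Algebra K A] where
  /-- The Lie bracket `{a, b}`. -/
  bracket : A →ₗ[K] A →ₗ[K] A
  bracket_self : ∀ a, bracket a a = 0
  jacobi : ∀ a b c, bracket a (bracket b c) = bracket (bracket a b) c + bracket b (bracket a c)
  leibniz : ∀ a b c, bracket a (b * c) = bracket a b * c + b * bracket a c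

namespace PoissonAlgebra

variable (K A : Type*) [CommRing K] [Ring A] [Algebra K A] [PoissonAlgebra K A]

/-- The Lie algebra `(A, {-,-})`: a copy of `A`, so that the Poisson bracket is not confused with
the commutator. -/
@[nolint unusedArguments]
def LieAlg (K A : Type*) [CommRing K] [Ring A] [Algebra K A] [PoissonAlgebra K A] : Type _ := A

instance : AddCommGroup (LieAlg K A) := inferInstanceAs (AddCommGroup A)

instance : Module K (LieAlg K A) := inferInstanceAs (Module K A)

instance : LieRing (LieAlg K A) where
  bracket := fun a b : A => bracket (K := K) a b
  add_lie := fun a b c : A => by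
    change bracket (K := K) (a + b) c = bracket (K := K) a c + bracket (K := K) b c
    rw [map_add, LinearMap.add_apply]
  lie_add := fun a b c : A => map_add (bracket (K := K) a) b c
  lie_self := fun a : A => bracket_self (K := K) a
  leibniz_lie := fun a b c : A => jacobi (K := K) a b c

instance : LieAlgebra K (LieAlg K A) where
  lie_smul := fun r (a b : A) => map_smul (bracket (K := K) a) r b

/-- The adjoint action of the Lie algebra `(A, {-,-})` on the space `A`. -/
def ad : LieAlg K A →ₗ⁅K⁆ Module.End K A where
  toFun := fun a : A => bracket (K := K) a
  map_add' := fun a b : A => map_add (bracket (K := K)) a b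
  map_smul' := fun r (a : A) => map_smul (bracket (K := K)) r a
  map_lie' := fun {a b : A} => by
    ext c
    change bracket (K := K) (bracket (K := K) a b) c =
      bracket (K := K) a (bracket (K := K) b c) - bracket (K := K) b (bracket (K := K) a c)
    rw [jacobi (K := K) a b c]; abel

/-- The adjoint action on the space `Aᵐᵒᵖ`. -/
def adOp (x : LieAlg K A) : Module.End K Aᵐᵒᵖ :=
  (MulOpposite.opLinearEquiv K).conj (ad K A x)

/-- The action `x(a ⊗ b') = {x, a} ⊗ b' + a ⊗ {x, b}'` of the Lie algebra `(A, {-,-})` on the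
enveloping algebra `A ⊗ Aᵐᵒᵖ`. -/
def envelopingAction : LieDerivationAction K (LieAlg K A) (A ⊗[K] Aᵐᵒᵖ) where
  toFun x := (ad K A x).rTensor Aᵐᵒᵖ + (adOp K A x).lTensor A
  map_add' x y := by
    simp only [adOp, map_add, LinearMap.rTensor_add, LinearMap.lTensor_add]; abel
  map_smul' r x := by
    simp only [adOp, map_smul, LinearMap.rTensor_smul, LinearMap.lTensor_smul, smul_add,
      RingHom.id_apply]
  map_lie' {x y} := by
    ext a b
    simp [adOp, LieRing.of_associative_ring_bracket, TensorProduct.sub_tmul,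
      TensorProduct.tmul_sub]
    abel
  leibniz' x p q := by
    have h : ∀ a b : A, ad K A x (a * b) = ad K A x a * b + a * ad K A x b :=
      fun a b => leibniz (K := K) (show A from x) a b
    induction p with
    | zero => simp
    | add p p' hp hp' => simp only [add_mul, map_add] at hp hp' ⊢; rw [hp, hp']; abel
    | tmul a b =>
      induction q with
      | zero => simp
      | add q q' hq hq' => simp only [mul_add, map_add] at hq hq' ⊢; rw [hq, hq']; abel
      | tmul c d =>
        simp [adOp, h, TensorProduct.add_tmul, TensorProduct.tmul_add, add_mul, mul_add]
        abel

/-- The quasi-Poisson enveloping algebra `Q(A) = Aᵉ # U(A)`. -/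
abbrev QuasiPoissonEnveloping : Type _ := SmashProduct (envelopingAction K A)

/-- The action of `Q(A)` on `A`: `(a ⊗ b' # h) m = a h(m) b`. -/
def quasiPoissonAction : QuasiPoissonEnveloping K A →ₐ[K] Module.End K A :=
  SmashProduct.lift (AlgHom.mulLeftRight K A) (ad K A) (fun x p => by
    have h : ∀ a b : A, ad K A x (a * b) = ad K A x a * b + a * ad K A x b :=
      fun a b => leibniz (K := K) (show A from x) a b
    induction p with
    | zero => simp
    | add p q hp hq => simp only [map_add, mul_add, add_mul, hp, hq]; abel
    | tmul a b =>
      ext m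
      simp [envelopingAction, adOp, h, AlgHom.mulLeftRight_apply, add_mul]
      abel)

end PoissonAlgebra

section Cohomology

open PoissonAlgebra

/-- `A` as a module over `Aᵉ = A ⊗ Aᵐᵒᵖ`: `(a ⊗ b') m = a m b`. -/
def regularBimodule (K A : Type u) [CommRing K] [Ring A] [Algebra K A] :
    ModuleCat.{u} (A ⊗[K] Aᵐᵒᵖ) :=
  letI := Module.compHom A (AlgHom.mulLeftRight K A).toRingHom
  ModuleCat.of (A ⊗[K] Aᵐᵒᵖ) A

/-- `A` as a module over `Q(A)`, i.e. as a quasi-Poisson module over itself. -/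
def regularQuasiPoissonModule (K A : Type u) [CommRing K] [Ring A] [Algebra K A]
    [PoissonAlgebra K A] : ModuleCat.{u} (QuasiPoissonEnveloping K A) :=
  letI := Module.compHom A (quasiPoissonAction K A).toRingHom
  ModuleCat.of (QuasiPoissonEnveloping K A) A

/-- The Hochschild cohomology algebra `HH^*(A) = Ext^*_{Aᵉ}(A, A)`. -/
abbrev HochschildCohomology (K A : Type u) [Field K] [Ring A] [Algebra K A] : Type u :=
  YonedaAlgebra (regularBimodule K A)

/-- `HHⁿ(A)` as a subspace of `HH^*(A)`. -/
abbrev hochschildGrading (K A : Type u) [Field K] [Ring A] [Algebra K A] :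
    ℕ → Submodule K (HochschildCohomology K A) :=
  yonedaGrading K (regularBimodule K A)

/-- The quasi-Poisson cohomology algebra `HQ^*(A) = Ext^*_{Q(A)}(A, A)`. -/
abbrev QuasiPoissonCohomology (K A : Type u) [Field K] [Ring A] [Algebra K A]
    [PoissonAlgebra K A] : Type u :=
  YonedaAlgebra (regularQuasiPoissonModule K A)

/-- `HQⁿ(A)` as a subspace of `HQ^*(A)`. -/
abbrev quasiPoissonGrading (K A : Type u) [Field K] [Ring A] [Algebra K A]
    [PoissonAlgebra K A] : ℕ → Submodule K (QuasiPoissonCohomology K A) :=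
  yonedaGrading K (regularQuasiPoissonModule K A)

end Cohomology

end

/-! For zero bracket, `U(A)` is a symmetric algebra acting on `Aᵉ` through its augmentation, so
`Q(A)` is the polynomial ring `Aᵉ[x₁, …, x_d]`, `d = dim A`, in central variables that all act by
zero on `A`. It is enough to adjoin one variable: if `M` is a `T`-module on which `X` is made to act
by zero, then `Ext_{T[X]}(M, M)` is `Ext_T(M, M)` with one exterior generator `ξ` of degree 1
adjoined. After `d` steps the generators span a copy of `K^d ≅ A`.

For one step, consider the exact functors `triv`, `forget` and `cofree = Hom_T(T[X], -)`.
Multiplication by `X` gives a short exact sequence `0 → triv M → cofree M → cofree M → 0`, and `ξ`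
is the pullback of its class along `triv M → cofree M`. By adjunction `Ext(triv M, cofree N) =
Ext(M, N)`, and `X` acts on it by zero, so the long exact sequence breaks up and every class of
positive degree is uniquely `triv x + (triv y) ξ` (`exists_eq_mapExactFunctor_add`,
`injective_mapExactFunctor_add`). Over `T` the sequence splits, hence `forget ξ = 0`, which forces
`ξ² = 0` (`varClass_comp_varClass`). The sign in commuting `ξ` past a class of degree `n` comes from
the anticommutativity of the border of a `3 × 3` diagram (`extClass_comp_extClass_add`,
`varClass_comp`).

`IsExteriorExtension.comp_simple` iterates the step, and `exists_smashProduct_equiv` identifies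
`Q(A)` with the iterated polynomial ring by comparing universal properties, so that no basis of
`U(A)` is needed. -/

noncomputable section

attribute [local instance 100] LieRing.ofAssociativeRing

/-! ### Functoriality of `Ext` -/

namespace CategoryTheory.Abelian.Ext

open Limits

section

variable {C : Type*} [Category C] [Abelian C] [HasExt.{u} C] [EnoughProjectives C]

/-- Dimension shifting along `0 → ker → P → X → 0` with `P` projective: `Ext^{n+1}(P, Y) = 0`, so
the connecting map is onto. The equation `S.X₃ = X` is kept so that callers can eliminate `X` by
`rfl`. -/
theorem exists_extClass_comp {X Y : C} {n : ℕ} (x : Ext X Y (n + 1)) :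
    ∃ (S : ShortComplex C) (hS : S.ShortExact) (e : S.X₃ = X) (y : Ext S.X₁ Y n),
      x = e ▸ hS.extClass.comp y (add_comm 1 n) := by
  let S := ShortComplex.mk _ _ (kernel.condition (Projective.π X))
  have hS : S.ShortExact :=
    { exact := ShortComplex.exact_of_f_is_kernel _ (kernelIsKernel S.g) }
  obtain ⟨y, hy⟩ := contravariant_sequence_exact₃ hS Y x (eq_zero_of_projective _) (add_comm 1 n)
  exact ⟨S, hS, rfl, y, hy.symm⟩

/-- With enough projectives, every class of positive degree is the product of the class of a short
exact sequence with a class of smaller degree. -/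
theorem extClass_induction {Y : C} {motive : ∀ ⦃n : ℕ⦄ ⦃X : C⦄, Ext X Y n → Prop}
    (mk₀ : ∀ ⦃X : C⦄ (f : X ⟶ Y), motive (mk₀ f))
    (extClass_comp : ∀ ⦃n : ℕ⦄ (S : ShortComplex C) (hS : S.ShortExact) (y : Ext S.X₁ Y n),
      motive y → motive (hS.extClass.comp y (add_comm 1 n)))
    {n : ℕ} {X : C} (x : Ext X Y n) : motive x := by
  induction n generalizing X with
  | zero =>
    obtain ⟨f, rfl⟩ := (mk₀_bijective X Y).2 x
    exact mk₀ f
  | succ n hn =>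
    obtain ⟨S, hS, rfl, y, rfl⟩ := exists_extClass_comp x
    exact extClass_comp S hS y (hn y)

end

section

variable {C D E : Type*} [Category C] [Abelian C] [HasExt.{u} C] [EnoughProjectives C]
  [Category D] [Abelian D] [HasExt.{u} D] [Category E] [Abelian E] [HasExt.{u} E]
  (F G : C ⥤ D) [F.Additive] [PreservesFiniteLimits F] [PreservesFiniteColimits F]
  [G.Additive] [PreservesFiniteLimits G] [PreservesFiniteColimits G]
  (H : D ⥤ E) [H.Additive] [PreservesFiniteLimits H] [PreservesFiniteColimits H]

/-- In degree zero this is naturality of `τ`. On the class of a short exact sequence it holds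
because `τ` gives a morphism between the two image sequences; products then follow by associativity.
-/
theorem mapExactFunctor_naturality (τ : F ⟶ G) {X Y : C} {n : ℕ} (x : Ext X Y n) :
    (x.mapExactFunctor F).comp (mk₀ (τ.app Y)) (add_zero n) =
      (mk₀ (τ.app X)).comp (x.mapExactFunctor G) (zero_add n) := by
  induction x using extClass_induction with
  | mk₀ f => simp [mapExactFunctor_mk₀]
  | @extClass_comp n S hS y hy =>
    have h : (hS.extClass.mapExactFunctor F).comp (mk₀ (τ.app S.X₁)) (add_zero 1) =
        (mk₀ (τ.app S.X₃)).comp (hS.extClass.mapExactFunctor G) (zero_add 1) := by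
      rw [mapExactFunctor_extClass, mapExactFunctor_extClass]
      exact (hS.map_of_exact F).extClass_naturality (hS.map_of_exact G) (S.mapNatTrans τ)
    rw [mapExactFunctor_comp, mapExactFunctor_comp, comp_assoc_of_third_deg_zero, hy,
      ← comp_assoc_of_second_deg_zero, h, comp_assoc _ _ _ (zero_add 1) (add_comm 1 n) (by omega)]

theorem mapExactFunctor_id {X Y : C} {n : ℕ} (x : Ext X Y n) :
    x.mapExactFunctor (𝟭 C) = x := by
  induction x using extClass_induction with
  | mk₀ f => rw [mapExactFunctor_mk₀]; rfl
  | @extClass_comp n S hS y hy =>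
    rw [mapExactFunctor_comp, mapExactFunctor_extClass, hy]
    rfl

theorem mapExactFunctor_functorComp {X Y : C} {n : ℕ} (x : Ext X Y n) :
    x.mapExactFunctor (F ⋙ H) = (x.mapExactFunctor F).mapExactFunctor H := by
  induction x using extClass_induction with
  | mk₀ f => simp only [mapExactFunctor_mk₀]; rfl
  | @extClass_comp n S hS y hy =>
    have h : hS.extClass.mapExactFunctor (F ⋙ H) =
        (hS.extClass.mapExactFunctor F).mapExactFunctor H := by
      rw [mapExactFunctor_extClass, mapExactFunctor_extClass]
      exact (mapExactFunctor_extClass H (hS.map_of_exact F)).symm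
    rw [mapExactFunctor_comp, mapExactFunctor_comp, mapExactFunctor_comp, hy, h]

variable {F} {V : D ⥤ C} [V.Additive] [PreservesFiniteLimits V] [PreservesFiniteColimits V]

omit [EnoughProjectives C] in
/-- For exact adjoint functors `V ⊣ F`, a class in `Ext(M, F N)` whose adjunct in `Ext(V M, N)`
vanishes is zero. -/
theorem eq_zero_of_adjunct_eq_zero [EnoughProjectives D] (adj : V ⊣ F) {M : D} {N : C} {n : ℕ}
    (x : Ext M (F.obj N) n)
    (hx : (x.mapExactFunctor V).comp (mk₀ (adj.counit.app N)) (add_zero n) = 0) : x = 0 := by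
  -- Naturality of the unit `η` along `x`, followed by a triangle identity, recovers `x` from its
  -- adjunct: `x = η · F(V x · ε)`.
  have h1 := mapExactFunctor_naturality (𝟭 D) (V ⋙ F) adj.unit x
  rw [mapExactFunctor_id, mapExactFunctor_functorComp] at h1
  have h2 := congrArg (fun z => z.comp (mk₀ (F.map (adj.counit.app N))) (add_zero n)) h1
  have h3 : (0 : Ext (V.obj M) N n).mapExactFunctor F = 0 := mapExactFunctor_zero F _ _ n
  rw [← hx, mapExactFunctor_comp, mapExactFunctor_mk₀] at h3
  simp only [comp_assoc_of_third_deg_zero, mk₀_comp_mk₀] at h2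
  have h4 : adj.unit.app (F.obj N) ≫ F.map (adj.counit.app N) = 𝟙 _ :=
    adj.right_triangle_components N
  erw [h4, h3] at h2
  simpa using h2

end

/-! ### Anticommutativity of Yoneda products in a `3 × 3` diagram -/

section

variable {C : Type*} [Category C] [Abelian C] [HasExt.{u} C]

theorem comp_zsmul {X Y Z : C} {a b c : ℕ} (k : ℤ) (x : Ext X Y a) (y : Ext Y Z b)
    (h : a + b = c) : x.comp (k • y) h = k • x.comp y h :=
  map_zsmul (x.precomp Z h) k y

theorem zsmul_comp {X Y Z : C} {a b c : ℕ} (k : ℤ) (x : Ext X Y a) (y : Ext Y Z b)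
    (h : a + b = c) : (k • x).comp y h = k • x.comp y h :=
  map_zsmul (y.postcomp X h) k x

/-- In a `3 × 3` diagram with short exact rows and columns, the two Yoneda products along the
border of the diagram are opposite to each other. -/
theorem extClass_comp_extClass_add {S₁ S₂ S₃ : ShortComplex C} (r₁ : S₁.ShortExact)
    (r₂ : S₂.ShortExact) (r₃ : S₃.ShortExact) (φ : S₁ ⟶ S₂) (ψ : S₂ ⟶ S₃) (w : φ ≫ ψ = 0)
    (c₁ : (ShortComplex.mk φ.τ₁ ψ.τ₁ (congrArg ShortComplex.Hom.τ₁ w)).ShortExact)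
    (c₂ : (ShortComplex.mk φ.τ₂ ψ.τ₂ (congrArg ShortComplex.Hom.τ₂ w)).ShortExact)
    (c₃ : (ShortComplex.mk φ.τ₃ ψ.τ₃ (congrArg ShortComplex.Hom.τ₃ w)).ShortExact) :
    Ext.comp (X := S₃.X₃) (Y := S₁.X₃) c₃.extClass r₁.extClass rfl +
      r₃.extClass.comp (Y := S₃.X₁) c₁.extClass rfl = (0 : Ext S₃.X₃ S₁.X₁ (1 + 1)) := by
  have w₁ : φ.τ₁ ≫ ψ.τ₁ = 0 := congrArg ShortComplex.Hom.τ₁ w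
  have w₂ : φ.τ₂ ≫ ψ.τ₂ = 0 := congrArg ShortComplex.Hom.τ₂ w
  have : Mono φ.τ₃ := c₃.mono_f
  have : Mono S₂.f := r₂.mono_f
  have : Mono S₁.f := r₁.mono_f
  have : Mono S₃.f := r₃.mono_f
  have : Epi S₁.g := r₁.epi_g
  have : Epi S₃.g := r₃.epi_g
  have : Epi ψ.τ₂ := c₂.epi_g
  -- `F` is the kernel of the diagonal epimorphism onto the corner `S₃.X₃`. The classes of `c₃` and
  -- `r₃` are the pushouts of the single extension `W` along `a` and `b`, so it remains to compare
  -- the pullbacks of `r₁` along `a` and of `c₁` along `b`.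
  let F := kernel (ψ.τ₂ ≫ S₃.g)
  let k : F ⟶ S₂.X₂ := kernel.ι (ψ.τ₂ ≫ S₃.g)
  have hk : k ≫ ψ.τ₂ ≫ S₃.g = 0 := kernel.condition _
  let a : F ⟶ S₁.X₃ := c₃.exact.lift (k ≫ S₂.g) (by simpa [ψ.comm₂₃] using hk)
  have ha : a ≫ φ.τ₃ = k ≫ S₂.g := c₃.exact.lift_f _ _
  let b : F ⟶ S₃.X₁ := r₃.exact.lift (k ≫ ψ.τ₂) (by simpa using hk)
  have hb : b ≫ S₃.f = k ≫ ψ.τ₂ := r₃.exact.lift_f _ _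
  let W := ShortComplex.mk k (ψ.τ₂ ≫ S₃.g) hk
  have hW : W.ShortExact :=
    { exact := ShortComplex.exact_of_f_is_kernel _ (kernelIsKernel _)
      mono_f := inferInstanceAs (Mono (kernel.ι _))
      epi_g := epi_comp _ _ }
  let p : S₁.X₂ ⊞ S₂.X₁ ⟶ F := kernel.lift _ (biprod.desc φ.τ₂ S₂.f) (by
    ext
    · simp [reassoc_of% w₂]
    · simp [← ψ.comm₁₂_assoc])
  have hp : p ≫ k = biprod.desc φ.τ₂ S₂.f := kernel.lift_ι _ _ _
  have : Mono k := inferInstanceAs (Mono (kernel.ι _))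
  -- `F` is the sum of the subobjects `S₁.X₂` and `S₂.X₁` of `S₂.X₂`, which meet in `S₁.X₁`. Both
  -- pullbacks turn out to be this extension up to sign.
  let Z := ShortComplex.mk (biprod.lift S₁.f (-φ.τ₁)) p (by
    rw [← cancel_mono k, Category.assoc, hp]
    simp [biprod.lift_desc, φ.comm₁₂])
  have hZ : Z.ShortExact :=
    { exact := by
        rw [ShortComplex.exact_iff_exact_up_to_refinements]
        intro A x hx
        have hx' : (x ≫ biprod.fst) ≫ φ.τ₂ + (x ≫ biprod.snd) ≫ S₂.f = 0 := by
          have := congrArg (· ≫ k) hx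
          simpa [Z, hp, biprod.desc_eq] using this
        have h0 : (x ≫ biprod.fst) ≫ S₁.g = 0 := by
          rw [← cancel_mono φ.τ₃]
          have := congrArg (· ≫ S₂.g) hx'
          simpa [φ.comm₂₃] using this
        refine ⟨A, 𝟙 A, inferInstance, r₁.exact.lift _ h0, ?_⟩
        have h1 : r₁.exact.lift _ h0 ≫ S₁.f = x ≫ biprod.fst := r₁.exact.lift_f _ _
        simp only [Z, Category.id_comp]
        ext
        · simp [h1]
        · rw [← cancel_mono S₂.f]
          rw [← h1] at hx'
          have h2 : (x ≫ biprod.snd) ≫ S₂.f = -((r₁.exact.lift _ h0 ≫ S₁.f) ≫ φ.τ₂) :=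
            eq_neg_of_add_eq_zero_right hx'
          simp only [h2]
          simp [φ.comm₁₂]
      mono_f := by
        have : Mono (biprod.lift S₁.f (-φ.τ₁) ≫ biprod.fst) := by
          rw [biprod.lift_fst]; infer_instance
        exact mono_of_mono _ (biprod.fst : S₁.X₂ ⊞ S₂.X₁ ⟶ _)
      epi_g := by
        rw [epi_iff_surjective_up_to_refinements]
        intro A y
        obtain ⟨A', π, hπ, x, hx⟩ := surjective_up_to_refinements_of_epi S₁.g (y ≫ a)
        -- After `y ≫ a` is lifted to `S₁.X₂`, the error vanishes in `S₂.X₃` and so comes from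
        -- `S₂.X₁`.
        have h0 : (π ≫ y ≫ k - x ≫ φ.τ₂) ≫ S₂.g = 0 := by
          have := congrArg (· ≫ φ.τ₃) hx
          simp only [Category.assoc, ha] at this
          simp [this, φ.comm₂₃]
        have h1 := r₂.exact.lift_f _ h0
        refine ⟨A', π, hπ, biprod.lift x (r₂.exact.lift _ h0), ?_⟩
        rw [← cancel_mono k]
        simp only [Z, Category.assoc, hp, biprod.lift_desc, h1]
        abel }
  have hσa : c₃.extClass = hW.extClass.comp (mk₀ a) (add_zero 1) := by
    have := hW.extClass_naturality c₃
      { τ₁ := a, τ₂ := S₂.g, τ₃ := 𝟙 _, comm₁₂ := ha, comm₂₃ := by simp [W, ψ.comm₂₃] }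
    rw [mk₀_id_comp] at this
    exact this.symm
  have hσb : r₃.extClass = hW.extClass.comp (mk₀ b) (add_zero 1) := by
    have := hW.extClass_naturality r₃
      { τ₁ := b, τ₂ := ψ.τ₂, τ₃ := 𝟙 _, comm₁₂ := hb, comm₂₃ := by simp [W] }
    rw [mk₀_id_comp] at this
    exact this.symm
  have hZa : (mk₀ a).comp r₁.extClass (zero_add 1) = hZ.extClass := by
    have := hZ.extClass_naturality r₁
      { τ₁ := 𝟙 _, τ₂ := biprod.fst, τ₃ := a, comm₁₂ := by simp [Z], comm₂₃ := by
          rw [← cancel_mono φ.τ₃]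
          simp only [Z, Category.assoc, ha]
          rw [reassoc_of% hp]
          ext <;> simp [φ.comm₂₃] }
    rw [comp_mk₀_id] at this
    exact this.symm
  have hZb : (mk₀ b).comp (Z := S₁.X₁) c₁.extClass (zero_add 1) = -hZ.extClass := by
    have := hZ.extClass_naturality c₁
      -- The sign of the result arises here: the second component of the inclusion in `Z` is
      -- `-φ.τ₁`.
      { τ₁ := -𝟙 _, τ₂ := biprod.snd, τ₃ := b, comm₁₂ := by simp [Z], comm₂₃ := by
          rw [← cancel_mono S₃.f]
          simp only [Z, Category.assoc, hb]
          rw [reassoc_of% hp]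
          ext <;> simp [ψ.comm₁₂, w₂] }
    rw [mk₀_neg, comp_neg, comp_mk₀_id] at this
    exact this.symm
  rw [hσa, hσb, comp_assoc_of_second_deg_zero, comp_assoc_of_second_deg_zero, hZa, hZb, comp_neg,
    add_neg_cancel]

end

end CategoryTheory.Abelian.Ext

/-! ### Adjoining an endomorphism -/

open Limits in
/-- The situation of the categories `C` of modules over a ring `T` and `D` of modules over `T[X]`:
`triv` lets `X` act by zero, `forget` forgets the action of `X`, `cofree` is the right adjoint
of `forget`, and `var` is multiplication by `X`. -/
structure AdjoinEndomorphism {C D : Type*} [Category C] [Abelian C] [Category D] [Abelian D]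
    (triv : C ⥤ D) (forget : D ⥤ C) (cofree : C ⥤ D) where
  adj : forget ⊣ cofree
  retraction : triv ⋙ forget ≅ 𝟭 C
  var : 𝟭 D ⟶ 𝟭 D
  var_triv (X : C) : var.app (triv.obj X) = 0
  incl : triv ⟶ cofree
  forget_map_incl (X : C) : forget.map (incl.app X) ≫ adj.counit.app X = retraction.hom.app X
  incl_var (X : C) : incl.app X ≫ var.app (cofree.obj X) = 0
  shortExact (X : C) : (ShortComplex.mk (incl.app X) (var.app (cofree.obj X))
    (incl_var X)).ShortExact
  exists_section (X : C) :
    ∃ s : forget.obj (cofree.obj X) ⟶ forget.obj (cofree.obj X),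
      s ≫ forget.map (var.app (cofree.obj X)) = 𝟙 _

namespace AdjoinEndomorphism

set_option linter.unusedSectionVars false

open Limits Ext

variable {C D : Type*} [Category C] [Abelian C] [HasExt.{u} C] [EnoughProjectives C]
  [Category D] [Abelian D] [HasExt.{u} D] [EnoughProjectives D]
  {triv : C ⥤ D} {forget : D ⥤ C} {cofree : C ⥤ D}
  [triv.Additive] [PreservesFiniteLimits triv] [PreservesFiniteColimits triv]
  [forget.Additive] [PreservesFiniteLimits forget] [PreservesFiniteColimits forget]
  [cofree.Additive] [PreservesFiniteLimits cofree] [PreservesFiniteColimits cofree]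
  (A : AdjoinEndomorphism triv forget cofree)

/-- The class of `0 ⟶ triv X ⟶ cofree X ⟶ cofree X ⟶ 0`. -/
def cofreeClass (X : C) : Ext (cofree.obj X) (triv.obj X) 1 := (A.shortExact X).extClass

/-- The class in `Ext¹(triv X, triv X)` of the extension given by the dual numbers over `X`. -/
def varClass (X : C) : Ext (triv.obj X) (triv.obj X) 1 :=
  (mk₀ (A.incl.app X)).comp (A.cofreeClass X) (zero_add 1)

/-- Multiplication by the variable on cofree objects. -/
def cofreeVar : cofree ⟶ cofree where
  app X := A.var.app (cofree.obj X)
  naturality _ _ f := A.var.naturality (cofree.map f)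

/-- Applying `0 → triv → cofree → cofree → 0` to a short exact sequence gives a `3 × 3` diagram,
whose border products are opposite. Each of the `n` short exact sequences composing `x` thus
contributes one sign. -/
theorem cofreeClass_comp {M N : C} {n : ℕ} (x : Ext M N n) :
    (A.cofreeClass M).comp (x.mapExactFunctor triv) (add_comm 1 n) =
      (-1 : ℤ) ^ n • (x.mapExactFunctor cofree).comp (A.cofreeClass N) rfl := by
  induction x using extClass_induction with
  | @mk₀ X f =>
    have h := (A.shortExact X).extClass_naturality (A.shortExact N)
      { τ₁ := triv.map f, τ₂ := cofree.map f, τ₃ := cofree.map f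
        comm₁₂ := A.incl.naturality f, comm₂₃ := A.cofreeVar.naturality f }
    rw [mapExactFunctor_mk₀, mapExactFunctor_mk₀, pow_zero, one_smul]
    exact h
  | @extClass_comp n S hS y hy =>
    have h : (A.cofreeClass S.X₃).comp (hS.extClass.mapExactFunctor triv) rfl =
        -(hS.extClass.mapExactFunctor cofree).comp (A.cofreeClass S.X₁) rfl := by
      rw [mapExactFunctor_extClass, mapExactFunctor_extClass]
      exact eq_neg_of_add_eq_zero_left (extClass_comp_extClass_add (hS.map_of_exact triv)
        (hS.map_of_exact cofree) (hS.map_of_exact cofree) (S.mapNatTrans A.incl)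
        (S.mapNatTrans A.cofreeVar) (by ext <;> exact A.incl_var _)
        (A.shortExact S.X₁) (A.shortExact S.X₂) (A.shortExact S.X₃))
    rw [mapExactFunctor_comp, mapExactFunctor_comp,
      ← comp_assoc _ _ _ rfl (add_comm 1 n) (by omega), h, neg_comp,
      comp_assoc _ _ _ rfl (add_comm 1 n) (by omega), hy, comp_zsmul, pow_succ, mul_neg_one, neg_smul,
      ← comp_assoc _ _ _ (add_comm 1 n) rfl (by omega)]

theorem varClass_comp {M N : C} {n : ℕ} (x : Ext M N n) :
    (A.varClass M).comp (x.mapExactFunctor triv) (add_comm 1 n) =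
      (-1 : ℤ) ^ n • (x.mapExactFunctor triv).comp (A.varClass N) rfl := by
  rw [varClass, varClass, comp_assoc _ _ _ (zero_add 1) (add_comm 1 n) (by omega), cofreeClass_comp,
    comp_zsmul, ← comp_assoc _ _ _ (zero_add n) rfl (by omega),
    ← mapExactFunctor_naturality triv cofree A.incl, comp_assoc_of_second_deg_zero]

/-- After forgetting the variable, multiplication by it acquires a section, so the cofree sequence
splits and its class vanishes. -/
theorem mapExactFunctor_forget_varClass (X : C) : (A.varClass X).mapExactFunctor forget = 0 := by
  obtain ⟨s, hs⟩ := A.exists_section X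
  have h : (A.cofreeClass X).mapExactFunctor forget = 0 := by
    have h1 : (mk₀ (A.var.app (cofree.obj X))).comp (A.cofreeClass X) (zero_add 1) = 0 :=
      (A.shortExact X).comp_extClass
    have h2 := congrArg (fun z => (mk₀ s).comp (z.mapExactFunctor forget) (zero_add 1)) h1
    simp only [mapExactFunctor_zero, Ext.comp_zero, mapExactFunctor_comp, mapExactFunctor_mk₀] at h2
    rw [← comp_assoc_of_second_deg_zero, mk₀_comp_mk₀] at h2
    erw [hs, mk₀_id_comp] at h2
    exact h2
  rw [varClass, mapExactFunctor_comp, h, Ext.comp_zero]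

/-- The adjunct in `Ext(X, Y)` of a class in `Ext(triv X, cofree Y)`. -/
def adjunct {X Y : C} {n : ℕ} (x : Ext (triv.obj X) (cofree.obj Y) n) : Ext X Y n :=
  (mk₀ (A.retraction.inv.app X)).comp
    ((x.mapExactFunctor forget).comp (mk₀ (A.adj.counit.app Y)) (add_zero n)) (zero_add n)

theorem adjunct_sub {X Y : C} {n : ℕ} (x y : Ext (triv.obj X) (cofree.obj Y) n) :
    A.adjunct (x - y) = A.adjunct x - A.adjunct y := by
  have h : (x - y).mapExactFunctor forget = x.mapExactFunctor forget - y.mapExactFunctor forget :=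
    map_sub (forget.mapExtAddHom _ _ n) x y
  simp only [adjunct, h]
  simp [sub_eq_add_neg]

theorem adjunct_zero {X Y : C} {n : ℕ} :
    A.adjunct (0 : Ext (triv.obj X) (cofree.obj Y) n) = 0 := by
  simpa using A.adjunct_sub (0 : Ext (triv.obj X) (cofree.obj Y) n) 0

theorem adjunct_injective {X Y : C} {n : ℕ} :
    Function.Injective (A.adjunct : Ext (triv.obj X) (cofree.obj Y) n → Ext X Y n) := by
  intro x y hxy
  rw [← sub_eq_zero, ← adjunct_sub] at hxy
  rw [← sub_eq_zero]
  apply eq_zero_of_adjunct_eq_zero A.adj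
  have h := congrArg (fun z => (mk₀ (A.retraction.hom.app X)).comp z (zero_add n)) hxy
  simp only [adjunct, mk₀_comp_mk₀_assoc, Ext.comp_zero] at h
  erw [A.retraction.hom_inv_id_app, mk₀_id_comp] at h
  exact h

/-- `adjunct` is injective and has `x ↦ triv x · incl` as a right inverse, so `Ext(triv X, cofree
Y)` is a copy of `Ext(X, Y)` and `triv` is split injective on `Ext`. -/
theorem adjunct_comp_incl {X Y : C} {n : ℕ} (x : Ext X Y n) :
    A.adjunct ((x.mapExactFunctor triv).comp (mk₀ (A.incl.app Y)) (add_zero n)) = x := by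
  have h := mapExactFunctor_naturality (triv ⋙ forget) (𝟭 C) A.retraction.hom x
  rw [mapExactFunctor_id, mapExactFunctor_functorComp] at h
  rw [adjunct, mapExactFunctor_comp, mapExactFunctor_mk₀, comp_assoc_of_second_deg_zero,
    mk₀_comp_mk₀, A.forget_map_incl]
  erw [h]
  rw [mk₀_comp_mk₀_assoc]
  erw [A.retraction.inv_hom_id_app, mk₀_id_comp]

theorem varClass_comp_incl (X : C) :
    (A.varClass X).comp (mk₀ (A.incl.app X)) (add_zero 1) = 0 := by
  apply A.adjunct_injective
  rw [adjunct_zero, adjunct, mapExactFunctor_comp, mapExactFunctor_forget_varClass,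
    Ext.zero_comp, Ext.zero_comp, Ext.comp_zero]

/-- The second factor is `incl · cofreeClass`, and the first one already dies after composition with
`incl` because its adjunct is computed from `forget ξ = 0`. -/
theorem varClass_comp_varClass (X : C) :
    (A.varClass X).comp (A.varClass X) rfl = (0 : Ext _ _ 2) := by
  have h : ∀ x : Ext (triv.obj X) (triv.obj X) 1, x.comp (A.varClass X) (rfl : 1 + 1 = 2) =
      (x.comp (mk₀ (A.incl.app X)) (add_zero 1)).comp (A.cofreeClass X) rfl := fun x => by
    rw [comp_assoc_of_second_deg_zero, varClass]
  rw [h, varClass_comp_incl, Ext.zero_comp]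

theorem injective_mapExactFunctor_add {X Y : C} {n : ℕ} (x : Ext X Y (n + 1)) (y : Ext X Y n)
    (h : x.mapExactFunctor triv + (y.mapExactFunctor triv).comp (A.varClass Y) rfl = 0) :
    x = 0 ∧ y = 0 := by
  -- Pushing the relation to `cofree Y` kills the `ξ` term, and the adjunct of what is left is `x`.
  have h1 : x = 0 := by
    have h2 := congrArg (fun z => A.adjunct (z.comp (mk₀ (A.incl.app Y)) (add_zero _))) h
    simp only [Ext.add_comp, Ext.zero_comp, comp_assoc_of_third_deg_zero, varClass_comp_incl,
      Ext.comp_zero, add_zero, adjunct_comp_incl, adjunct_zero] at h2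
    exact h2
  refine ⟨h1, ?_⟩
  rw [h1, mapExactFunctor_zero, zero_add, varClass, ← comp_assoc_of_second_deg_zero] at h
  obtain ⟨z, hz⟩ := covariant_sequence_exact₃ _ (A.shortExact Y) _ rfl h
  -- The variable is a natural endomorphism of the identity, so its action on `Ext` through the
  -- target agrees with that through the source `triv X`, where it is zero.
  have h2 : z.comp (mk₀ (A.var.app (cofree.obj Y))) (add_zero n) = 0 := by
    have := mapExactFunctor_naturality (𝟭 D) (𝟭 D) A.var z
    rw [mapExactFunctor_id] at this
    erw [this]
    erw [A.var_triv, mk₀_zero, Ext.zero_comp]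
  have h3 : (y.mapExactFunctor triv).comp (mk₀ (A.incl.app Y)) (add_zero n) = 0 :=
    hz.symm.trans h2
  rw [← A.adjunct_comp_incl y, h3, adjunct_zero]

theorem exists_eq_mapExactFunctor_add {X Y : C} {n : ℕ}
    (z : Ext (triv.obj X) (triv.obj Y) (n + 1)) :
    ∃ (x : Ext X Y (n + 1)) (y : Ext X Y n),
      z = x.mapExactFunctor triv + (y.mapExactFunctor triv).comp (A.varClass Y) rfl := by
  -- `x` is the only candidate, since the `ξ` term vanishes in `cofree Y`. The difference `z - triv
  -- x` then lifts through the connecting map to some `w`, which is itself of the form `triv y ·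
  -- incl`.
  let x := A.adjunct (z.comp (mk₀ (A.incl.app Y)) (add_zero _))
  have h : (z - x.mapExactFunctor triv).comp (mk₀ (A.incl.app Y)) (add_zero _) = 0 := by
    apply A.adjunct_injective
    rw [sub_eq_add_neg, Ext.add_comp, Ext.neg_comp, ← sub_eq_add_neg, adjunct_sub,
      adjunct_comp_incl, adjunct_zero, sub_self]
  obtain ⟨w, hw⟩ := covariant_sequence_exact₁ _ (A.shortExact Y) _ h rfl
  refine ⟨x, A.adjunct w, ?_⟩
  have h1 : ((A.adjunct w).mapExactFunctor triv).comp (mk₀ (A.incl.app Y)) (add_zero n) = w :=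
    A.adjunct_injective (A.adjunct_comp_incl _)
  rw [varClass, ← comp_assoc_of_second_deg_zero, h1]
  exact (add_eq_of_eq_sub' hw).symm

/-- In degree zero there is no room for a `ξ` term: composition with the monomorphism `incl` is
injective on morphisms. -/
theorem bijective_mapExactFunctor_zero (A : AdjoinEndomorphism triv forget cofree) {X Y : C} :
    Function.Bijective
      (mapExactFunctor triv : Ext X Y 0 → Ext (triv.obj X) (triv.obj Y) 0) := by
  refine ⟨fun x y h => by rw [← A.adjunct_comp_incl x, h, adjunct_comp_incl], fun z => ?_⟩
  refine ⟨A.adjunct (z.comp (mk₀ (A.incl.app Y)) (add_zero _)), ?_⟩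
  have := (A.shortExact Y).mono_f
  apply postcomp_mk₀_injective_of_mono (triv.obj X) (A.incl.app Y)
  exact A.adjunct_injective (A.adjunct_comp_incl _)

end AdjoinEndomorphism

/-! ### Modules over polynomial rings -/

namespace ModuleCat

open Limits Polynomial

instance restrictScalars_preservesFiniteLimits {R S : Type u} [Ring R] [Ring S] (f : R →+* S) :
    PreservesFiniteLimits (restrictScalars.{u} f) :=
  ⟨fun _ _ _ => ⟨fun {_} => inferInstance⟩⟩

instance coextendScalars_additive {R S : Type u} [Ring R] [Ring S] (f : R →+* S) :
    (coextendScalars.{u, u, u} f).Additive where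
  map_add {_ _ _ _} := by ext; rfl

/-- Coextension of scalars along `f : R →+* S` is exact if `S` is projective over `R`. -/
theorem coextendScalars_preservesFiniteColimits {R S : Type u} [Ring R] [Ring S] (f : R →+* S)
    [Module.Projective R ((restrictScalars f).obj (of S S))] :
    PreservesFiniteColimits (coextendScalars.{u, u, u} f) := by
  apply ((Functor.preservesFiniteColimits_tfae (coextendScalars.{u, u, u} f)).out 0 3).1
  intro S hS
  have hF : PreservesFiniteLimits (coextendScalars.{u, u, u} f) := inferInstance
  have h : ∀ S : ShortComplex (ModuleCat.{u} R), S.ShortExact →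
      (S.map (coextendScalars.{u, u, u} f)).Exact ∧ Mono ((coextendScalars.{u, u, u} f).map S.f) :=
    ((Functor.preservesFiniteLimits_tfae (coextendScalars.{u, u, u} f)).out 3 0).1 hF
  refine ⟨(h S hS).1, ?_⟩
  have hg := (epi_iff_surjective _).1 hS.epi_g
  rw [epi_iff_surjective]
  intro h
  obtain ⟨k, hk⟩ := Module.projective_lifting_property S.g.hom (CoextendScalars.equiv f _ h) hg
  exact ⟨(CoextendScalars.equiv f _).symm k, (CoextendScalars.equiv f _).injective hk⟩

variable (T : Type u) [Ring T]

/-- `T[X]` as a `T`-module, by restriction of scalars along `C`. -/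
def polynomialRestrictEquiv : T[X] ≃ₗ[T] (restrictScalars (C : T →+* T[X])).obj (of T[X] T[X]) where
  __ := AddEquiv.refl T[X]
  map_smul' r p := smul_eq_C_mul (p := p) r

instance projective_restrictScalars_C :
    Module.Projective T ((restrictScalars (C : T →+* T[X])).obj (of T[X] T[X])) :=
  Module.Projective.of_equiv (polynomialRestrictEquiv T)

instance coextendScalars_C_preservesFiniteColimits :
    PreservesFiniteColimits (coextendScalars.{u, u, u} (C : T →+* T[X])) :=
  coextendScalars_preservesFiniteColimits _

/-- Multiplication by `X`, as an endomorphism of the identity functor. -/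
def mulX : 𝟭 (ModuleCat.{u} T[X]) ⟶ 𝟭 (ModuleCat.{u} T[X]) where
  app M := ofHom
    { toFun := fun m : M => (X : T[X]) • m
      map_add' := smul_add _
      map_smul' := fun p m => by
        rw [RingHom.id_apply, ← mul_smul, ← mul_smul, X_mul] }
  naturality _ _ f := by
    ext m
    exact (f.hom.map_smul X m).symm

variable {T}

/-- The additive map underlying an element of `Hom_T(T[X], M)`. -/
def coextendEval {M : ModuleCat.{u} T} (h : (coextendScalars.{u, u, u} (C : T →+* T[X])).obj M) :
    T[X] →+ M where
  toFun p := CoextendScalars.equiv _ _ h p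
  map_zero' := map_zero (CoextendScalars.equiv _ _ h)
  map_add' := map_add (CoextendScalars.equiv _ _ h)

theorem coextendEval_C_mul {M : ModuleCat.{u} T}
    (h : (coextendScalars.{u, u, u} (C : T →+* T[X])).obj M) (r : T) (p : T[X]) :
    coextendEval h (C r * p) = r • coextendEval h p :=
  (CoextendScalars.equiv _ _ h).map_smul r p

theorem coextendEval_injective {M : ModuleCat.{u} T} : Function.Injective
    (coextendEval : (coextendScalars.{u, u, u} (C : T →+* T[X])).obj M → T[X] →+ M) :=
  fun _ _ w => (CoextendScalars.equiv _ _).injective (LinearMap.ext fun p => DFunLike.congr_fun w p)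

/-- An element of `Hom_T(T[X], M)` from its underlying map. -/
def coextendMk {M : ModuleCat.{u} T} (φ : T[X] →+ M) (hφ : ∀ r p, φ (C r * p) = r • φ p) :
    (coextendScalars.{u, u, u} (C : T →+* T[X])).obj M :=
  (CoextendScalars.equiv _ _).symm { φ with map_smul' := hφ }

theorem coextendEval_smul {M : ModuleCat.{u} T} (p q : T[X])
    (h : (coextendScalars.{u, u, u} (C : T →+* T[X])).obj M) :
    coextendEval (p • h) q = coextendEval h (q * p) := rfl

/-- The map `M ⟶ Hom_T(T[X], M)`, `m ↦ (p ↦ p(0) m)`. -/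
def evalZeroApp (M : ModuleCat.{u} T) : (restrictScalars.{u} (constantCoeff (R := T))).obj M ⟶
    (coextendScalars.{u, u, u} (C : T →+* T[X])).obj M :=
  ofHom (X := (restrictScalars.{u} (constantCoeff (R := T))).obj M)
    { toFun := fun m : M => coextendMk
        { toFun := fun p => p.coeff 0 • m
          map_zero' := by simp
          map_add' := fun p q => by rw [coeff_add, add_smul] }
        (fun r p => by simp [mul_smul])
      map_add' := fun m m' : M => coextendEval_injective <|
        AddMonoidHom.ext fun p => smul_add (p.coeff 0) m m'
      map_smul' := fun (p : T[X]) (m : M) => coextendEval_injective <|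
        AddMonoidHom.ext fun q => by
          change q.coeff 0 • p.coeff 0 • m = (q * p).coeff 0 • m
          rw [mul_coeff_zero, mul_smul] }

/-- Precomposition with `p ↦ (p - p(0)) / X` on `Hom_T(T[X], M)`. -/
def precompDivX {M : ModuleCat.{u} T}
    (h : (coextendScalars.{u, u, u} (C : T →+* T[X])).obj M) :
    (coextendScalars.{u, u, u} (C : T →+* T[X])).obj M :=
  coextendMk ((coextendEval h).comp divX_hom) fun r p => by
    simp [divX_C_mul, coextendEval_C_mul]

theorem coextendEval_precompDivX {M : ModuleCat.{u} T}
    (h : (coextendScalars.{u, u, u} (C : T →+* T[X])).obj M) (p : T[X]) :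
    coextendEval (precompDivX h) p = coextendEval h p.divX := rfl

/-- `divX` is a left inverse of multiplication by `X` on `T[X]`. This gives both the surjectivity of
`X` on `Hom_T(T[X], M)` and the `T`-linear section that splits the cofree sequence. -/
theorem X_smul_precompDivX {M : ModuleCat.{u} T}
    (h : (coextendScalars.{u, u, u} (C : T →+* T[X])).obj M) :
    (X : T[X]) • precompDivX h = h :=
  coextendEval_injective <| AddMonoidHom.ext fun p => by
    rw [coextendEval_smul, coextendEval_precompDivX]
    congr 1
    ext n
    simp [coeff_divX]

/-- `precompDivX` as a `T`-linear endomorphism. -/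
def divXApp (M : ModuleCat.{u} T) :
    (restrictScalars.{u} (C : T →+* T[X])).obj ((coextendScalars.{u, u, u} C).obj M) ⟶
      (restrictScalars.{u} (C : T →+* T[X])).obj ((coextendScalars.{u, u, u} C).obj M) :=
  ofHom (X := (restrictScalars.{u} (C : T →+* T[X])).obj ((coextendScalars.{u, u, u} C).obj M))
    (Y := (restrictScalars.{u} (C : T →+* T[X])).obj ((coextendScalars.{u, u, u} C).obj M))
    { toFun := precompDivX
      map_add' := fun _ _ => rfl
      map_smul' := fun r h => coextendEval_injective <| AddMonoidHom.ext fun p => by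
        change coextendEval h (p.divX * C r) = coextendEval h (p * C r).divX
        congr 1
        ext n
        simp [coeff_divX] }

theorem evalZeroApp_comp_mulX (M : ModuleCat.{u} T) :
    evalZeroApp M ≫ (mulX T).app ((coextendScalars.{u, u, u} C).obj M) = 0 := by
  refine hom_ext <| LinearMap.ext fun m => coextendEval_injective <| AddMonoidHom.ext fun p => ?_
  change (p * X).coeff 0 • (show M from m) = 0
  rw [mul_coeff_zero, coeff_X_zero, mul_zero, zero_smul]

theorem shortExact_evalZeroApp_mulX (M : ModuleCat.{u} T) :
    (ShortComplex.mk (evalZeroApp M) ((mulX T).app ((coextendScalars.{u, u, u} C).obj M))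
      (evalZeroApp_comp_mulX M)).ShortExact where
  exact := by
    rw [ShortComplex.moduleCat_exact_iff]
    intro (h : (coextendScalars.{u, u, u} C).obj M) hh
    -- If `X • h = 0`, then `h` vanishes on multiples of `X`, hence `h(p) = p(0) h(1)`.
    refine ⟨coextendEval h 1, coextendEval_injective <| AddMonoidHom.ext fun p => ?_⟩
    have h1 : coextendEval h (p.divX * X) = 0 :=
      DFunLike.congr_fun (congrArg coextendEval hh) p.divX
    have h2 := coextendEval_C_mul h (p.coeff 0) 1
    have h3 := map_add (coextendEval h) (p.divX * X) (C (p.coeff 0) * 1)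
    rw [h1, h2, mul_one, divX_mul_X_add, zero_add] at h3
    exact h3.symm
  mono_f := by
    rw [mono_iff_injective]
    intro (m : M) (m' : M) h
    have := DFunLike.congr_fun (congrArg coextendEval h) 1
    change (1 : T[X]).coeff 0 • m = (1 : T[X]).coeff 0 • m' at this
    rw [coeff_one_zero, one_smul, one_smul] at this
    exact this
  epi_g := by
    rw [epi_iff_surjective]
    exact fun h => ⟨precompDivX h, X_smul_precompDivX h⟩

variable (T)

/-- The adjoint functors between modules over `T` and over `T[X]`. -/
def polynomialAdjoinEndomorphism :
    AdjoinEndomorphism (restrictScalars.{u} (constantCoeff (R := T)))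
      (restrictScalars.{u} (C : T →+* T[X])) (coextendScalars.{u, u, u} C) where
  adj := restrictCoextendScalarsAdj C
  retraction := (restrictScalarsComp' C constantCoeff (RingHom.id T) (by ext; simp)).symm ≪≫
    restrictScalarsId' (RingHom.id T) rfl
  var := mulX T
  var_triv M := hom_ext <| LinearMap.ext fun (m : M) => by
    change (X : T[X]).coeff 0 • m = 0
    rw [coeff_X_zero, zero_smul]
  incl :=
    { app := evalZeroApp
      naturality := fun M N f => hom_ext <| LinearMap.ext fun (m : M) =>
        coextendEval_injective <| AddMonoidHom.ext fun p =>
          (f.hom.map_smul (p.coeff 0) m).symm }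
  forget_map_incl M := hom_ext <| LinearMap.ext fun (m : M) => by
    change (1 : T[X]).coeff 0 • m = m
    rw [coeff_one_zero, one_smul]
  incl_var := evalZeroApp_comp_mulX
  shortExact := shortExact_evalZeroApp_mulX
  exists_section M := ⟨divXApp M, hom_ext <| LinearMap.ext fun h => X_smul_precompDivX h⟩

end ModuleCat

/-! ### Exterior extensions of graded algebras -/

section ExteriorExtension

variable {K : Type*} [CommRing K] {E₀ E E' V W : Type*} [Ring E₀] [Algebra K E₀] [Ring E]
  [Algebra K E] [Ring E'] [Algebra K E'] [AddCommGroup V] [Module K V] [AddCommGroup W] [Module K W]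

/-- The graded algebra `E` is an exterior algebra on `V` over the graded algebra `E₀`, in the sense
that `E₀ ᵍ⊗ ⋀ V ≃ E` through `φ : E₀ → E` and `v : V → E`. -/
structure IsExteriorExtension (𝒜 : ℕ → Submodule K E₀) (ℬ : ℕ → Submodule K E) (φ : E₀ →ₐ[K] E)
    (v : V →ₗ[K] E) : Prop where
  map_mem : ∀ i, ∀ a ∈ 𝒜 i, φ a ∈ ℬ i
  gen_mem : ∀ x, v x ∈ ℬ 1
  sq_zero : ∀ x, v x * v x = 0
  anticomm : ∀ i, ∀ a ∈ 𝒜 i, ∀ x, v x * φ a = (-1 : ℤ) ^ i • (φ a * v x)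
  bijective : Function.Bijective (LinearMap.mul' K E ∘ₗ
    TensorProduct.map φ.toLinearMap (ExteriorAlgebra.lift K ⟨v, sq_zero⟩).toLinearMap)

/-- The graded algebra `E` is an exterior algebra on one generator `ξ` over the graded
algebra `E₀`. -/
structure IsSimpleExteriorExtension (𝒜 : ℕ → Submodule K E₀) (ℬ : ℕ → Submodule K E)
    (φ : E₀ →ₐ[K] E) (ξ : E) : Prop where
  map_mem : ∀ i, ∀ a ∈ 𝒜 i, φ a ∈ ℬ i
  gen_mem : ξ ∈ ℬ 1
  sq_zero : ξ * ξ = 0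
  anticomm : ∀ i, ∀ a ∈ 𝒜 i, ξ * φ a = (-1 : ℤ) ^ i • (φ a * ξ)
  bijective : Function.Bijective fun p : E₀ × E₀ => φ p.1 + φ p.2 * ξ

/-- Only existence of this normal form is needed; in `comp_simple` its uniqueness comes for free
from a bijectivity on the target side. -/
theorem ExteriorAlgebra.exists_eq_map_inl_add (x : ExteriorAlgebra K (V × K)) :
    ∃ a b : ExteriorAlgebra K V, x = ExteriorAlgebra.map (LinearMap.inl K V K) a +
      ExteriorAlgebra.map (LinearMap.inl K V K) b * ExteriorAlgebra.ι K (0, 1) := by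
  induction x using CliffordAlgebra.right_induction with
  | algebraMap r => exact ⟨algebraMap K _ r, 0, by simp⟩
  | add x y hx hy =>
    obtain ⟨a, b, rfl⟩ := hx
    obtain ⟨a', b', rfl⟩ := hy
    exact ⟨a + a', b + b', by simp only [map_add, add_mul]; abel⟩
  | mul_ι m x hx =>
    obtain ⟨a, b, rfl⟩ := hx
    obtain ⟨w, c⟩ := m
    -- With `ξ` for the new generator, `(a + bξ)(w + cξ) = aw + (ca - bw)ξ`.
    refine ⟨a * ExteriorAlgebra.ι K w, c • a - b * ExteriorAlgebra.ι K w, ?_⟩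
    have h1 : ExteriorAlgebra.ι K ((w, c) : V × K) =
        ExteriorAlgebra.ι K (w, 0) + c • ExteriorAlgebra.ι K (0, 1) := by
      rw [← map_smul, ← map_add]; simp
    have h2 : ExteriorAlgebra.ι K ((0, 1) : V × K) * ExteriorAlgebra.ι K (w, 0) =
        -(ExteriorAlgebra.ι K (w, 0) * ExteriorAlgebra.ι K (0, 1)) :=
      eq_neg_of_add_eq_zero_left (ExteriorAlgebra.ι_add_mul_swap _ _)
    have h3 : ExteriorAlgebra.ι K ((0, 1) : V × K) * ExteriorAlgebra.ι K (0, 1) = 0 :=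
      ExteriorAlgebra.ι_sq_zero _
    change _ * ExteriorAlgebra.ι K (w, c) = _
    rw [h1]
    simp only [map_mul, map_sub, map_smul, ExteriorAlgebra.map_apply_ι, LinearMap.inl_apply,
      add_mul, mul_add, mul_assoc, h2, h3, mul_smul_comm, mul_zero, sub_mul, mul_neg,
      smul_mul_assoc]
    abel_nf

variable {𝒜 : ℕ → Submodule K E₀} {ℬ : ℕ → Submodule K E} {ℬ' : ℕ → Submodule K E'}

/-- The isomorphism of exterior algebras induced by a linear equivalence. -/
def ExteriorAlgebra.mapEquiv (e : W ≃ₗ[K] V) : ExteriorAlgebra K W ≃ₐ[K] ExteriorAlgebra K V :=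
  AlgEquiv.ofAlgHom (map e.toLinearMap) (map e.symm.toLinearMap)
    (by rw [map_comp_map, LinearEquiv.comp_symm, map_id])
    (by rw [map_comp_map, LinearEquiv.symm_comp, map_id])

theorem ExteriorAlgebra.lift_comp_mapEquiv (v : V →ₗ[K] E) (hv : ∀ x, v x * v x = 0)
    (e : W ≃ₗ[K] V) :
    (lift K ⟨v, hv⟩).comp (mapEquiv e).toAlgHom =
      lift K ⟨v ∘ₗ e.toLinearMap, fun x => hv (e x)⟩ := by
  ext x
  simp [mapEquiv]

namespace IsExteriorExtension

variable {φ : E₀ →ₐ[K] E} {v : V →ₗ[K] E}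

theorem refl [Subsingleton V] : IsExteriorExtension 𝒜 𝒜 (AlgHom.id K E₀) (0 : V →ₗ[K] E₀) where
  map_mem _ _ h := h
  gen_mem _ := zero_mem _
  sq_zero _ := mul_zero _
  anticomm _ _ _ _ := by simp
  bijective := by
    have h : ∀ x : ExteriorAlgebra K V, ∃ r, x = algebraMap K _ r := fun x => by
      induction x using CliffordAlgebra.right_induction with
      | algebraMap r => exact ⟨r, rfl⟩
      | add x y hx hy =>
        obtain ⟨a, rfl⟩ := hx
        obtain ⟨b, rfl⟩ := hy
        exact ⟨a + b, (map_add _ _ _).symm⟩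
      | mul_ι m x hx => exact ⟨0, by rw [Subsingleton.elim m 0]; simp⟩
    have h' : ∀ t : E₀ ⊗[K] ExteriorAlgebra K V, ∃ a, t = a ⊗ₜ 1 := fun t => by
      induction t with
      | zero => exact ⟨0, by simp⟩
      | add x y hx hy =>
        obtain ⟨a, rfl⟩ := hx
        obtain ⟨b, rfl⟩ := hy
        exact ⟨a + b, (TensorProduct.add_tmul _ _ _).symm⟩
      | tmul a x =>
        obtain ⟨r, rfl⟩ := h x
        exact ⟨r • a, by rw [Algebra.algebraMap_eq_smul_one, TensorProduct.smul_tmul]⟩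
    refine ⟨?_, fun a => ⟨a ⊗ₜ 1, by simp⟩⟩
    rw [← LinearMap.ker_eq_bot, LinearMap.ker_eq_bot']
    intro t ht
    obtain ⟨a, rfl⟩ := h' t
    have : a = 0 := by simpa using ht
    rw [this, TensorProduct.zero_tmul]

theorem comp_linearEquiv (h : IsExteriorExtension 𝒜 ℬ φ v) (e : W ≃ₗ[K] V) :
    IsExteriorExtension 𝒜 ℬ φ (v ∘ₗ e.toLinearMap) where
  map_mem := h.map_mem
  gen_mem x := h.gen_mem (e x)
  sq_zero x := h.sq_zero (e x)
  anticomm i a ha x := h.anticomm i a ha (e x)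
  bijective := by
    let g := LinearEquiv.lTensor E₀ (ExteriorAlgebra.mapEquiv e).toLinearEquiv
    have hg : LinearMap.mul' K E ∘ₗ TensorProduct.map φ.toLinearMap
          (ExteriorAlgebra.lift K ⟨v ∘ₗ e.toLinearMap, fun x => h.sq_zero (e x)⟩).toLinearMap =
        (LinearMap.mul' K E ∘ₗ TensorProduct.map φ.toLinearMap
          (ExteriorAlgebra.lift K ⟨v, h.sq_zero⟩).toLinearMap) ∘ₗ g.toLinearMap :=
      TensorProduct.ext' fun a x => congrArg (φ a * ·)
        (DFunLike.congr_fun (ExteriorAlgebra.lift_comp_mapEquiv v h.sq_zero e) x).symm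
    rw [hg]
    exact h.bijective.comp g.bijective

theorem comp_algEquiv (h : IsExteriorExtension 𝒜 ℬ φ v) (g : E ≃ₐ[K] E')
    (hg : ∀ i, ∀ a ∈ ℬ i, g a ∈ ℬ' i) :
    IsExteriorExtension 𝒜 ℬ' (g.toAlgHom.comp φ) (g.toLinearMap ∘ₗ v) where
  map_mem i a ha := hg i _ (h.map_mem i a ha)
  gen_mem x := hg 1 _ (h.gen_mem x)
  sq_zero x := by simp [← map_mul, h.sq_zero]
  anticomm i a ha x := by
    simpa using congrArg g (h.anticomm i a ha x)
  bijective := by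
    have sq : ∀ x, (g.toLinearMap ∘ₗ v) x * (g.toLinearMap ∘ₗ v) x = 0 := fun x => by
      simp [← map_mul, h.sq_zero]
    have hl : ExteriorAlgebra.lift K ⟨g.toLinearMap ∘ₗ v, sq⟩ =
        g.toAlgHom.comp (ExteriorAlgebra.lift K ⟨v, h.sq_zero⟩) := by
      ext; simp
    have hg : LinearMap.mul' K E' ∘ₗ TensorProduct.map (g.toAlgHom.comp φ).toLinearMap
          (ExteriorAlgebra.lift K ⟨g.toLinearMap ∘ₗ v, sq⟩).toLinearMap =
        g.toLinearMap ∘ₗ (LinearMap.mul' K E ∘ₗ TensorProduct.map φ.toLinearMap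
          (ExteriorAlgebra.lift K ⟨v, h.sq_zero⟩).toLinearMap) :=
      TensorProduct.ext' fun a x => by simp [hl]
    rw [hg]
    exact g.bijective.comp h.bijective

/-- The surjection `F` from two copies of `E₀ ⊗ ⋀V` onto `E₀ ⊗ ⋀(V × K)`, followed by the
multiplication map in question, is a composite of the two given bijections. Hence the multiplication
map is bijective too. -/
theorem comp_simple (h : IsExteriorExtension 𝒜 ℬ φ v) {φ' : E →ₐ[K] E'} {ξ : E'}
    (h' : IsSimpleExteriorExtension ℬ ℬ' φ' ξ) :
    IsExteriorExtension 𝒜 ℬ' (φ'.comp φ)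
      ((φ'.toLinearMap ∘ₗ v).coprod (LinearMap.toSpanSingleton K E' ξ)) := by
  have sq : ∀ x, (φ'.toLinearMap ∘ₗ v).coprod (LinearMap.toSpanSingleton K E' ξ) x *
      (φ'.toLinearMap ∘ₗ v).coprod (LinearMap.toSpanSingleton K E' ξ) x = 0 := fun x => by
    have := h'.anticomm 1 _ (h.gen_mem x.1)
    simp [mul_add, add_mul, ← map_mul, h.sq_zero, h'.sq_zero, this]
  refine ⟨fun i a ha => h'.map_mem i _ (h.map_mem i a ha), fun x => add_mem
    (h'.map_mem 1 _ (h.gen_mem x.1)) (Submodule.smul_mem _ _ h'.gen_mem), sq, ?_, ?_⟩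
  · intro i a ha x
    have h1 := h'.anticomm i _ (h.map_mem i a ha)
    have h2 := congrArg φ' (h.anticomm i a ha x.1)
    simp only [map_mul, map_zsmul] at h2
    simp [add_mul, mul_add, h1, h2, smul_comm]
  · let F : (E₀ ⊗[K] ExteriorAlgebra K V) × (E₀ ⊗[K] ExteriorAlgebra K V) →ₗ[K]
        E₀ ⊗[K] ExteriorAlgebra K (V × K) :=
      ((ExteriorAlgebra.map (LinearMap.inl K V K)).toLinearMap.lTensor E₀).coprod
        ((LinearMap.mulRight K (ExteriorAlgebra.ι K ((0, 1) : V × K)) ∘ₗ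
          (ExteriorAlgebra.map (LinearMap.inl K V K)).toLinearMap).lTensor E₀)
    have hF : Function.Surjective F := fun t => by
      induction t with
      | zero => exact ⟨0, map_zero _⟩
      | add x y hx hy =>
        obtain ⟨a, rfl⟩ := hx
        obtain ⟨b, rfl⟩ := hy
        exact ⟨a + b, map_add _ _ _⟩
      | tmul a x =>
        obtain ⟨b, c, rfl⟩ := ExteriorAlgebra.exists_eq_map_inl_add x
        exact ⟨(a ⊗ₜ b, a ⊗ₜ c), by simp [F, TensorProduct.tmul_add]⟩
    let Ψ := LinearMap.mul' K E ∘ₗ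
      TensorProduct.map φ.toLinearMap (ExteriorAlgebra.lift K ⟨v, h.sq_zero⟩).toLinearMap
    have hbij := h'.bijective.comp (h.bijective.prodMap h.bijective)
    have hl : ∀ x, ExteriorAlgebra.lift K ⟨_, sq⟩
        (ExteriorAlgebra.map (LinearMap.inl K V K) x) =
          φ' (ExteriorAlgebra.lift K ⟨v, h.sq_zero⟩ x) := fun x => by
      have : (ExteriorAlgebra.lift K ⟨_, sq⟩).comp (ExteriorAlgebra.map (LinearMap.inl K V K)) =
          φ'.comp (ExteriorAlgebra.lift K ⟨v, h.sq_zero⟩) := by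
        ext; simp
      exact DFunLike.congr_fun this x
    have hcomp : LinearMap.mul' K E' ∘ₗ TensorProduct.map (φ'.comp φ).toLinearMap
          (ExteriorAlgebra.lift K ⟨_, sq⟩).toLinearMap ∘ₗ F =
        (φ'.toLinearMap ∘ₗ Ψ).coprod (LinearMap.mulRight K ξ ∘ₗ φ'.toLinearMap ∘ₗ Ψ) := by
      refine LinearMap.prod_ext (TensorProduct.ext' fun a x => ?_)
        (TensorProduct.ext' fun a x => ?_)
      · simp [F, Ψ, hl]
      · simp [F, Ψ, hl, mul_assoc]
    replace hcomp := DFunLike.congr_fun hcomp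
    constructor
    · intro x y hxy
      obtain ⟨p, rfl⟩ := hF x
      obtain ⟨q, rfl⟩ := hF y
      exact congrArg F (hbij.1 ((hcomp p).symm.trans (hxy.trans (hcomp q))))
    · intro z
      obtain ⟨p, hp⟩ := hbij.2 z
      exact ⟨F p, (hcomp p).trans hp⟩

end IsExteriorExtension

end ExteriorExtension

/-! ### From exterior extensions to graded tensor products -/

section GradedTensor

variable {K : Type*} [CommRing K] {E₀ E V : Type*} [Ring E₀] [Algebra K E₀] [Ring E]
  [Algebra K E] [AddCommGroup V] [Module K V]
  {𝒜 : ℕ → Submodule K E₀} {ℬ : ℕ → Submodule K E} {φ : E₀ →ₐ[K] E} {v : V →ₗ[K] E}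

namespace IsExteriorExtension

/-- The sign rule required by `GradedTensorProduct.lift`; each of the `j` generators in `b`
contributes `(-1)^i`. -/
theorem mul_lift_anticomm (h : IsExteriorExtension 𝒜 ℬ φ v) ⦃i j : ℕ⦄ (a : 𝒜 i) (b : ⋀[K]^j V) :
    φ a * ExteriorAlgebra.lift K ⟨v, h.sq_zero⟩ b =
      (-1 : ℤˣ) ^ (j * i) • (ExteriorAlgebra.lift K ⟨v, h.sq_zero⟩ b * φ a) := by
  obtain ⟨b, hb⟩ := b
  induction hb using Submodule.pow_induction_on_left' with
  | algebraMap r => simp [Algebra.commutes]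
  | add x y i hx hy hx' hy' =>
    simp only at hx' hy' ⊢
    rw [map_add, mul_add, add_mul, smul_add, hx', hy']
  | mem_mul m hm j x hx hx' =>
    obtain ⟨w, rfl⟩ := hm
    have h1 : φ a * v w = (-1 : ℤˣ) ^ i • (v w * φ a) := by
      rw [h.anticomm i a a.2 w, Units.smul_def, smul_smul, Units.val_pow_eq_pow_val, Units.val_neg,
        Units.val_one, ← mul_pow, neg_one_mul, neg_neg, one_pow, one_smul]
    simp only at hx' ⊢
    rw [map_mul, ExteriorAlgebra.lift_ι_apply, ← mul_assoc, h1, smul_mul_assoc, mul_assoc, hx',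
      mul_smul_comm, smul_smul, mul_assoc, Nat.succ_mul, pow_add, mul_comm]

theorem lift_mem (h : IsExteriorExtension 𝒜 ℬ φ v) [SetLike.GradedMonoid ℬ] {j : ℕ}
    {b : ExteriorAlgebra K V} (hb : b ∈ ⋀[K]^j V) :
    ExteriorAlgebra.lift K ⟨v, h.sq_zero⟩ b ∈ ℬ j := by
  induction hb using Submodule.pow_induction_on_left' with
  | algebraMap r =>
    rw [AlgHom.commutes, Algebra.algebraMap_eq_smul_one]
    exact Submodule.smul_mem _ _ SetLike.GradedOne.one_mem
  | add x y i hx hy hx' hy' => rw [map_add]; exact add_mem hx' hy'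
  | mem_mul m hm j x hx hx' =>
    obtain ⟨w, rfl⟩ := hm
    rw [map_mul, ExteriorAlgebra.lift_ι_apply, Nat.succ_eq_one_add]
    exact SetLike.GradedMul.mul_mem (h.gen_mem w) hx'

end IsExteriorExtension

variable {F : Type*} [Ring F] [Algebra K F] {𝒞 : ℕ → Submodule K F} [GradedAlgebra 𝒜]
  [GradedAlgebra 𝒞]

theorem gradedTensorProduct_induction {P : 𝒜 ᵍ⊗[K] 𝒞 → Prop} (zero : P 0)
    (add : ∀ s t, P s → P t → P (s + t))
    (tmul : ∀ i j, ∀ a ∈ 𝒜 i, ∀ b ∈ 𝒞 j, P (a ᵍ⊗ₜ[K] b)) (t : 𝒜 ᵍ⊗[K] 𝒞) : P t := by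
  change P (GradedTensorProduct.of K 𝒜 𝒞 ((GradedTensorProduct.of K 𝒜 𝒞).symm t))
  induction (GradedTensorProduct.of K 𝒜 𝒞).symm t with
  | zero => rwa [map_zero]
  | add s t hs ht => rw [map_add]; exact add _ _ hs ht
  | tmul a b =>
    induction a using DirectSum.Decomposition.inductionOn 𝒜 with
    | zero => rwa [TensorProduct.zero_tmul, map_zero]
    | add x y hx hy => rw [TensorProduct.add_tmul, map_add]; exact add _ _ hx hy
    | @homogeneous i a =>
      induction b using DirectSum.Decomposition.inductionOn 𝒞 with
      | zero => rwa [TensorProduct.tmul_zero, map_zero]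
      | add x y hx hy => rw [TensorProduct.tmul_add, map_add]; exact add _ _ hx hy
      | @homogeneous j b => exact tmul i j a a.2 b b.2

/-- A bijective algebra map from a graded tensor product which maps the degree `n` part into the
degree `n` part maps it onto the degree `n` part. -/
theorem map_gradedTensorDegree_eq [GradedAlgebra ℬ] (f : (𝒜 ᵍ⊗[K] 𝒞) ≃ₐ[K] E)
    (hf : ∀ n, ∀ t ∈ gradedTensorDegree 𝒜 𝒞 n, f t ∈ ℬ n) (n : ℕ) :
    (ℬ n).map f.symm.toLinearMap = gradedTensorDegree 𝒜 𝒞 n := by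
  -- Taking components in `E` avoids proving that the tensor degrees are independent: it suffices
  -- that the degree `n` component of `f t` pulls back into degree `n`, which is checked on
  -- homogeneous tensors.
  have key : ∀ t, f.symm (DirectSum.decompose ℬ (f t) n) ∈ gradedTensorDegree 𝒜 𝒞 n := fun t => by
    induction t using gradedTensorProduct_induction with
    | zero => simp
    | add s t hs ht =>
      rw [map_add, DirectSum.decompose_add, DirectSum.add_apply, Submodule.coe_add, map_add]
      exact add_mem hs ht
    | tmul i j a ha b hb =>
      have hmem : a ᵍ⊗ₜ[K] b ∈ gradedTensorDegree 𝒜 𝒞 (i + j) :=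
        Submodule.subset_span ⟨i, j, rfl, a, ha, b, hb, rfl⟩
      by_cases hn : i + j = n
      · subst hn
        rw [DirectSum.decompose_of_mem_same ℬ (hf _ _ hmem), AlgEquiv.symm_apply_apply]
        exact hmem
      · rw [DirectSum.decompose_of_mem_ne ℬ (hf _ _ hmem) hn, map_zero]
        exact zero_mem _
  ext t
  constructor
  · rintro ⟨x, hx, rfl⟩
    have := key (f.symm x)
    rwa [AlgEquiv.apply_symm_apply, DirectSum.decompose_of_mem_same ℬ hx] at this
  · exact fun ht => ⟨f t, hf n t ht, f.symm_apply_apply t⟩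

theorem IsExteriorExtension.exists_gradedTensorProduct_equiv [GradedAlgebra ℬ]
    (h : IsExteriorExtension 𝒜 ℬ φ v) :
    ∃ e : E ≃ₐ[K] (𝒜 ᵍ⊗[K] fun i : ℕ => ⋀[K]^i V),
      ∀ n, (ℬ n).map e.toLinearMap = gradedTensorDegree 𝒜 (fun i : ℕ => ⋀[K]^i V) n := by
  let f := AlgEquiv.ofBijective
    (GradedTensorProduct.lift 𝒜 (fun i : ℕ => ⋀[K]^i V) φ (ExteriorAlgebra.lift K ⟨v, h.sq_zero⟩)
      h.mul_lift_anticomm) h.bijective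
  refine ⟨f.symm, map_gradedTensorDegree_eq f fun n t ht => ?_⟩
  induction ht using Submodule.span_induction with
  | mem t ht =>
    obtain ⟨i, j, rfl, a, ha, b, hb, rfl⟩ := ht
    exact SetLike.GradedMul.mul_mem (h.map_mem i a ha) (h.lift_mem hb)
  | zero => rw [map_zero]; exact zero_mem _
  | add x y _ _ hx hy => rw [map_add]; exact add_mem hx hy
  | smul r x _ hx => rw [map_smul]; exact Submodule.smul_mem _ _ hx

end GradedTensor

/-! ### Functoriality of the Yoneda algebra -/

section YonedaFunctoriality

open Limits

variable (K : Type*) [CommRing K] {C D : Type*} [Category C] [Abelian C] [HasExt.{u} C]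
  [Linear K C] [Category D] [Abelian D] [HasExt.{u} D] [Linear K D]

theorem yoneda_of_mul_of {X : C} {i j : ℕ} (α : Ext X X i) (β : Ext X X j) :
    (DirectSum.of (fun n : ℕ => Ext X X n) i α * DirectSum.of _ j β : YonedaAlgebra X) =
      DirectSum.of (fun n : ℕ => Ext X X n) (i + j) (β.comp α (add_comm j i)) :=
  DirectSum.of_mul_of (A := fun n : ℕ => Ext X X n) α β

theorem yoneda_of_comp_congr {X : C} {a b c c' : ℕ} (α : Ext X X a) (β : Ext X X b)
    (h : a + b = c) (h' : a + b = c') :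
    DirectSum.of (fun n : ℕ => Ext X X n) c (α.comp β h) =
      DirectSum.of (fun n : ℕ => Ext X X n) c' (α.comp β h') := by
  subst h; subst h'; rfl

theorem of_mem_yonedaGrading {X : C} {n : ℕ} (α : Ext X X n) :
    DirectSum.of (fun n : ℕ => Ext X X n) n α ∈ yonedaGrading K X n := ⟨α, rfl⟩

/-- The algebra map between Yoneda algebras induced by an exact functor. -/
def yonedaMap (F : C ⥤ D) [F.Additive] [F.Linear K] [PreservesFiniteLimits F]
    [PreservesFiniteColimits F] (X : C) : YonedaAlgebra X →ₐ[K] YonedaAlgebra (F.obj X) :=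
  DirectSum.toAlgebra K (fun n : ℕ => Ext X X n)
    (fun n => DirectSum.lof K ℕ (fun n : ℕ => Ext (F.obj X) (F.obj X) n) n ∘ₗ
      F.mapExtLinearMap K X X n)
    (congrArg (DirectSum.of (fun n : ℕ => Ext (F.obj X) (F.obj X) n) 0)
      ((Ext.mapExactFunctor_mk₀ F (𝟙 X)).trans (by rw [F.map_id]; rfl)))
    (fun α β => (congrArg (DirectSum.of (fun n : ℕ => Ext (F.obj X) (F.obj X) n) _)
      (Ext.mapExactFunctor_comp F β α _)).trans (yoneda_of_mul_of _ _).symm)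

variable (F : C ⥤ D) [F.Additive] [F.Linear K] [PreservesFiniteLimits F]
    [PreservesFiniteColimits F] (X : C)

theorem yonedaMap_of {n : ℕ} (α : Ext X X n) :
    yonedaMap K F X (DirectSum.of (fun n : ℕ => Ext X X n) n α) =
      DirectSum.of (fun n : ℕ => Ext (F.obj X) (F.obj X) n) n (α.mapExactFunctor F) :=
  DirectSum.toAddMonoid_of (β := fun n : ℕ => Ext X X n)
    (fun n => (DirectSum.lof K ℕ (fun n : ℕ => Ext (F.obj X) (F.obj X) n) n ∘ₗ
      F.mapExtLinearMap K X X n).toAddMonoidHom) n α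

theorem yonedaMap_mem {n : ℕ} {x : YonedaAlgebra X} (hx : x ∈ yonedaGrading K X n) :
    yonedaMap K F X x ∈ yonedaGrading K (F.obj X) n := by
  obtain ⟨α, rfl⟩ := hx
  rw [DirectSum.lof_eq_of, yonedaMap_of]
  exact of_mem_yonedaGrading K _

theorem yonedaMap_apply (x : YonedaAlgebra X) (n : ℕ) :
    yonedaMap K F X x n = (x n).mapExactFunctor F := by
  induction x using DirectSum.induction_on with
  | zero => simp
  | add x y hx hy => rw [map_add, DirectSum.add_apply, hx, hy, DirectSum.add_apply,
      Ext.mapExactFunctor_add]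
  | of i α =>
    rw [yonedaMap_of]
    by_cases h : i = n
    · subst h; rw [DirectSum.of_eq_same, DirectSum.of_eq_same]
    · rw [DirectSum.of_eq_of_ne _ _ _ (Ne.symm h), DirectSum.of_eq_of_ne _ _ _ (Ne.symm h),
        Ext.mapExactFunctor_zero]

theorem yonedaMap_bijective
    (hF : ∀ n, Function.Bijective (Ext.mapExactFunctor F : Ext X X n → _)) :
    Function.Bijective (yonedaMap K F X) := by
  constructor
  · intro x y hxy
    refine DFinsupp.ext fun n => (hF n).1 ?_
    have := DFunLike.congr_fun hxy n
    rwa [yonedaMap_apply, yonedaMap_apply] at this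
  · intro z
    induction z using DirectSum.induction_on with
    | zero => exact ⟨0, map_zero _⟩
    | add x y hx hy =>
      obtain ⟨a, rfl⟩ := hx
      obtain ⟨b, rfl⟩ := hy
      exact ⟨a + b, map_add _ _ _⟩
    | of i α =>
      obtain ⟨β, rfl⟩ := (hF i).2 α
      exact ⟨_, yonedaMap_of K F X β⟩

end YonedaFunctoriality

/-! ### The Yoneda algebra after adjoining one variable -/

section AdjoinVariable

open Limits Ext

variable (K : Type*) [CommRing K] {C D : Type*} [Category C] [Abelian C] [HasExt.{u} C]
  [EnoughProjectives C] [Linear K C] [Category D] [Abelian D] [HasExt.{u} D]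
  [EnoughProjectives D] [Linear K D] {triv : C ⥤ D} {forget : D ⥤ C} {cofree : C ⥤ D}
  [triv.Additive] [triv.Linear K] [PreservesFiniteLimits triv] [PreservesFiniteColimits triv]
  [forget.Additive] [PreservesFiniteLimits forget] [PreservesFiniteColimits forget]
  [cofree.Additive] [PreservesFiniteLimits cofree] [PreservesFiniteColimits cofree]
  (A : AdjoinEndomorphism triv forget cofree) (X : C)

namespace AdjoinEndomorphism

set_option linter.unusedSectionVars false

theorem yonedaMap_of_mul_varClass {n : ℕ} (α : Ext X X n) :
    yonedaMap K triv X (DirectSum.of (fun n : ℕ => Ext X X n) n α) *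
        DirectSum.of (fun n : ℕ => Ext (triv.obj X) (triv.obj X) n) 1 (A.varClass X) =
      DirectSum.of (fun n : ℕ => Ext (triv.obj X) (triv.obj X) n) (n + 1)
        ((A.varClass X).comp (α.mapExactFunctor triv) (add_comm 1 n)) := by
  rw [yonedaMap_of, yoneda_of_mul_of]

theorem yonedaMap_mul_varClass_zero (x : YonedaAlgebra X) :
    (yonedaMap K triv X x *
      DirectSum.of (fun n : ℕ => Ext (triv.obj X) (triv.obj X) n) 1 (A.varClass X)) 0 = 0 := by
  induction x using DirectSum.induction_on with
  | zero => rw [map_zero, zero_mul]; rfl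
  | add x y hx hy => rw [map_add, add_mul, DirectSum.add_apply, hx, hy, add_zero]
  | of i α =>
    rw [yonedaMap_of_mul_varClass, DirectSum.of_eq_of_ne _ _ _ (by omega)]

theorem yonedaMap_mul_varClass_succ (x : YonedaAlgebra X) (n : ℕ) :
    (yonedaMap K triv X x *
      DirectSum.of (fun n : ℕ => Ext (triv.obj X) (triv.obj X) n) 1 (A.varClass X)) (n + 1) =
      (A.varClass X).comp ((x n).mapExactFunctor triv) (add_comm 1 n) := by
  induction x using DirectSum.induction_on with
  | zero =>
    rw [map_zero, zero_mul, DirectSum.zero_apply, DirectSum.zero_apply, mapExactFunctor_zero,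
      Ext.comp_zero]
  | add x y hx hy =>
    rw [map_add, add_mul, DirectSum.add_apply, hx, hy, DirectSum.add_apply, mapExactFunctor_add,
      Ext.comp_add]
  | of i α =>
    rw [yonedaMap_of_mul_varClass]
    by_cases h : i = n
    · subst h; rw [DirectSum.of_eq_same, DirectSum.of_eq_same]
    · rw [DirectSum.of_eq_of_ne _ _ _ (by omega), DirectSum.of_eq_of_ne _ _ _ (Ne.symm h),
        mapExactFunctor_zero, Ext.comp_zero]

/-- The classwise results for `varClass`, assembled degree by degree. The product of the Yoneda
algebra reverses `Ext.comp`, so `φ(y) ξ` has `varClass` as its left `comp` factor. -/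
theorem isSimpleExteriorExtension :
    IsSimpleExteriorExtension (yonedaGrading K X) (yonedaGrading K (triv.obj X))
      (yonedaMap K triv X)
      (DirectSum.of (fun n : ℕ => Ext (triv.obj X) (triv.obj X) n) 1 (A.varClass X)) where
  map_mem _ _ h := yonedaMap_mem K triv X h
  gen_mem := of_mem_yonedaGrading K _
  sq_zero := by
    rw [yoneda_of_mul_of]
    exact (congrArg _ (A.varClass_comp_varClass X)).trans (map_zero _)
  anticomm i a ha := by
    obtain ⟨α, rfl⟩ := ha
    rw [DirectSum.lof_eq_of, yonedaMap_of_mul_varClass, varClass_comp, map_zsmul, smul_smul,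
      ← mul_pow, neg_one_mul, neg_neg, one_pow, one_smul, yonedaMap_of, yoneda_of_mul_of]
    exact yoneda_of_comp_congr _ _ _ _
  bijective := by
    -- The decomposition lemmas have `varClass` on the right; moving it across costs `(-1)^n`,
    -- absorbed into the coefficient. The same sign appears in the witness for surjectivity.
    have key (x : YonedaAlgebra X) (n : ℕ) :
        (A.varClass X).comp ((x n).mapExactFunctor triv) (add_comm 1 n) =
          (((-1 : ℤ) ^ n • x n).mapExactFunctor triv).comp (A.varClass X) rfl := by
      have : ((-1 : ℤ) ^ n • x n).mapExactFunctor triv = (-1 : ℤ) ^ n • (x n).mapExactFunctor triv :=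
        map_zsmul (triv.mapExtAddHom X X n) _ _
      rw [varClass_comp, this, zsmul_comp]
    constructor
    · have h0 (x y : YonedaAlgebra X) (h : yonedaMap K triv X x + yonedaMap K triv X y *
          DirectSum.of (fun n : ℕ => Ext (triv.obj X) (triv.obj X) n) 1 (A.varClass X) = 0) :
          x = 0 ∧ y = 0 := by
        have hn (n : ℕ) := congrArg (fun z : YonedaAlgebra (triv.obj X) => z n) h
        have hs (n : ℕ) : x (n + 1) = 0 ∧ y n = 0 := by
          have h1 := hn (n + 1)
          simp only [DirectSum.add_apply, yonedaMap_apply, DirectSum.zero_apply] at h1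
          rw [yonedaMap_mul_varClass_succ, key] at h1
          obtain ⟨h2, h3⟩ := A.injective_mapExactFunctor_add _ _ h1
          refine ⟨h2, ?_⟩
          have h4 := congrArg (fun z => (-1 : ℤ) ^ n • z) h3
          simpa only [smul_smul, ← mul_pow, neg_one_mul, neg_neg, one_pow, one_smul,
            smul_zero] using h4
        refine ⟨DFinsupp.ext fun n => ?_, DFinsupp.ext fun n => (hs n).2⟩
        cases n with
        | zero =>
          have h1 := hn 0
          simp only [DirectSum.add_apply, yonedaMap_apply, DirectSum.zero_apply] at h1
          rw [yonedaMap_mul_varClass_zero, add_zero] at h1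
          exact A.bijective_mapExactFunctor_zero.1 (h1.trans (mapExactFunctor_zero triv _ _ _).symm)
        | succ n => exact (hs n).1
      rintro ⟨x, y⟩ ⟨x', y'⟩ h
      obtain ⟨h1, h2⟩ := h0 (x - x') (y - y') (by
        rw [map_sub, map_sub, sub_mul, sub_add_sub_comm]
        exact sub_eq_zero.2 h)
      exact Prod.ext (sub_eq_zero.1 h1) (sub_eq_zero.1 h2)
    · intro z
      induction z using DirectSum.induction_on with
      | zero => exact ⟨0, by simp⟩
      | add x y hx hy =>
        obtain ⟨a, rfl⟩ := hx
        obtain ⟨b, rfl⟩ := hy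
        exact ⟨a + b, by simp only [Prod.fst_add, Prod.snd_add, map_add, add_mul]; abel⟩
      | of n z =>
        cases n with
        | zero =>
          obtain ⟨α, rfl⟩ := A.bijective_mapExactFunctor_zero.2 z
          exact ⟨(DirectSum.of _ 0 α, 0), by simp [yonedaMap_of]⟩
        | succ n =>
          obtain ⟨α, β, rfl⟩ := A.exists_eq_mapExactFunctor_add z
          refine ⟨(DirectSum.of _ (n + 1) α, (-1 : ℤ) ^ n • DirectSum.of _ n β), ?_⟩
          change yonedaMap K triv X _ + yonedaMap K triv X _ * _ = _
          rw [map_zsmul, smul_mul_assoc, yonedaMap_of_mul_varClass, yonedaMap_of, varClass_comp,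
            map_zsmul, smul_smul, ← mul_pow, neg_one_mul, neg_neg, one_pow, one_smul, map_add]

end AdjoinEndomorphism

end AdjoinVariable

/-! ### Central polynomial variables and Yoneda algebras -/

section PolynomialExtension

open Polynomial

variable {K : Type*} [Field K] {T Q : Type u} [Ring T] [Algebra K T] [Ring Q] [Algebra K Q]

/-- The algebra `Q` is a polynomial ring over `T` in the central variables `x j`. -/
structure IsPolynomialExtension {d : ℕ} (i : T →ₐ[K] Q) (x : Fin d → Q) : Prop where
  commute_var : ∀ j k, Commute (x j) (x k)
  commute_map : ∀ t j, Commute (i t) (x j)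
  adjoin_eq_top : Algebra.adjoin K (Set.range i ∪ Set.range x) = ⊤
  exists_lift : ∀ {S : Type u} [Ring S] [Algebra K S] (g : T →ₐ[K] S) (y : Fin d → S),
    (∀ j k, Commute (y j) (y k)) → (∀ t j, Commute (g t) (y j)) →
      ∃ G : Q →ₐ[K] S, (∀ t, G (i t) = g t) ∧ ∀ j, G (x j) = y j

namespace IsPolynomialExtension

theorem refl (x : Fin 0 → T) : IsPolynomialExtension (AlgHom.id K T) x where
  commute_var j := j.elim0
  commute_map _ j := j.elim0
  adjoin_eq_top := by
    rw [eq_top_iff]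
    exact fun t _ => Algebra.subset_adjoin (Or.inl ⟨t, rfl⟩)
  exists_lift g _ _ _ := ⟨g, fun _ => rfl, fun j => j.elim0⟩

variable {d : ℕ} {i : T →ₐ[K] Q} {x : Fin d → Q}

theorem induction (h : IsPolynomialExtension i x) {P : Q → Prop} (map : ∀ t, P (i t))
    (var : ∀ j, P (x j)) (add : ∀ p q, P p → P q → P (p + q))
    (mul : ∀ p q, P p → P q → P (p * q)) (q : Q) : P q := by
  have hq : q ∈ Algebra.adjoin K (Set.range i ∪ Set.range x) := h.adjoin_eq_top ▸ trivial
  induction hq using Algebra.adjoin_induction with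
  | mem q hq =>
    obtain ⟨t, rfl⟩ | ⟨j, rfl⟩ := hq
    exacts [map t, var j]
  | algebraMap r => exact i.commutes r ▸ map _
  | add p q _ _ hp hq => exact add p q hp hq
  | mul p q _ _ hp hq => exact mul p q hp hq

theorem algHom_ext (h : IsPolynomialExtension i x) {S : Type*} [Ring S] [Algebra K S]
    {f g : Q →ₐ[K] S} (hi : ∀ t, f (i t) = g (i t)) (hx : ∀ j, f (x j) = g (x j)) : f = g :=
  AlgHom.ext <| h.induction hi hx (fun p q hp hq => by rw [map_add, map_add, hp, hq])
    (fun p q hp hq => by rw [map_mul, map_mul, hp, hq])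

theorem polynomial (h : IsPolynomialExtension i x) :
    IsPolynomialExtension ((CAlgHom (R := K)).comp i)
      (Fin.cons X (C ∘ x) : Fin (d + 1) → Q[X]) where
  commute_var := Fin.cases (fun k => commute_X _) fun j => Fin.cases (commute_X _).symm
    fun k => (h.commute_var j k).map C
  commute_map t := Fin.cases (commute_X _).symm fun j => (h.commute_map t j).map C
  adjoin_eq_top := by
    rw [eq_top_iff]
    intro p _
    have hX : (X : Q[X]) ∈ Algebra.adjoin K (Set.range ((CAlgHom (R := K)).comp i) ∪
        Set.range (Fin.cons X (C ∘ x) : Fin (d + 1) → Q[X])) :=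
      Algebra.subset_adjoin (Or.inr ⟨0, rfl⟩)
    have hC (q : Q) : C q ∈ Algebra.adjoin K (Set.range ((CAlgHom (R := K)).comp i) ∪
        Set.range (Fin.cons X (C ∘ x) : Fin (d + 1) → Q[X])) := by
      induction q using h.induction with
      | map t => exact Algebra.subset_adjoin (Or.inl ⟨t, rfl⟩)
      | var j => exact Algebra.subset_adjoin (Or.inr ⟨j.succ, rfl⟩)
      | add p q hp hq => rw [C_add]; exact add_mem hp hq
      | mul p q hp hq => rw [C_mul]; exact mul_mem hp hq
    induction p using Polynomial.induction_on' with
    | add p q hp hq => exact add_mem (hp trivial) (hq trivial)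
    | monomial n q => rw [← C_mul_X_pow_eq_monomial]; exact mul_mem (hC q) (pow_mem hX n)
  exists_lift g y hy hg := by
    obtain ⟨G, h1, h2⟩ := h.exists_lift g (fun j => y j.succ) (fun j k => hy _ _) fun t j => hg _ _
    -- Evaluation at `y 0` requires it to commute with the image of all of `Q`, which is generated
    -- by `T` and the earlier variables.
    have hG : ∀ q, Commute (G q) (y 0) :=
      h.induction (fun t => by rw [h1]; exact hg t 0) (fun j => by rw [h2]; exact hy _ _)
        (fun p q hp hq => by rw [map_add]; exact hp.add_left hq)
        (fun p q hp hq => by rw [map_mul]; exact hp.mul_left hq)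
    refine ⟨eval₂AlgHom G (y 0) hG, fun t => ?_, Fin.cases ?_ fun j => ?_⟩
    · exact (eval₂_C _ _).trans (h1 t)
    · exact eval₂_X _ _
    · exact (eval₂_C _ _).trans (h2 j)

end IsPolynomialExtension

instance constantCoeff_restrictScalars_linear :
    (ModuleCat.restrictScalars.{u} (constantCoeff (R := T))).Linear K where
  map_smul {_ _} g r := by
    ext m
    exact congrArg (· • g.hom m) (show algebraMap K T r = (C (algebraMap K T r)).coeff 0 from
      coeff_C_zero.symm)

variable (K) in
/-- Evaluation of polynomials at zero, as an algebra map. -/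
def evalZeroAlgHom (Q : Type*) [Ring Q] [Algebra K Q] : Q[X] →ₐ[K] Q where
  __ := constantCoeff (R := Q)
  commutes' _ := coeff_C_zero

/-- The ring, its augmentation `π` killing the variables and the exterior structure are built in one
induction, because each step applies `triv` to the module obtained before it. -/
theorem exists_isPolynomialExtension (M : ModuleCat.{u} T)
    (d : ℕ) :
    ∃ (Q : Type u) (_ : Ring Q) (_ : Algebra K Q) (i : T →ₐ[K] Q) (x : Fin d → Q)
      (π : Q →ₐ[K] T), IsPolynomialExtension i x ∧ (∀ t, π (i t) = t) ∧ (∀ j, π (x j) = 0) ∧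
        ∃ φ, ∃ v : (Fin d → K) →ₗ[K] _, IsExteriorExtension (yonedaGrading K M)
          (yonedaGrading K ((ModuleCat.restrictScalars π.toRingHom).obj M)) φ v := by
  induction d with
  | zero =>
    exact ⟨T, inferInstance, inferInstance, AlgHom.id K T, Fin.elim0, AlgHom.id K T,
      IsPolynomialExtension.refl _, fun _ => rfl, fun j => j.elim0, AlgHom.id K _, 0,
      IsExteriorExtension.refl⟩
  | succ d ih =>
    obtain ⟨Q, _, _, i, x, π, h, hi, hx, φ, v, hφ⟩ := ih
    refine ⟨Q[X], inferInstance, inferInstance, _, _, π.comp (evalZeroAlgHom K Q), h.polynomial,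
      fun t => (congrArg π coeff_C_zero).trans (hi t),
      Fin.cases ((congrArg π coeff_X_zero).trans (map_zero π))
        fun j => (congrArg π coeff_C_zero).trans (hx j), ?_⟩
    -- `comp_simple` puts the new generator last whereas the new variable comes first, hence the
    -- swap in `K^{d+1} ≅ K × K^d ≅ K^d × K`.
    · exact ⟨_, _, (hφ.comp_simple ((ModuleCat.polynomialAdjoinEndomorphism
        Q).isSimpleExteriorExtension K
          ((ModuleCat.restrictScalars π.toRingHom).obj M))).comp_linearEquiv
        ((Fin.consLinearEquiv K fun _ => K).symm.trans (LinearEquiv.prodComm K _ _))⟩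

end PolynomialExtension

/-! ### Smash products with trivial action -/

namespace SmashProduct

variable {K L B : Type*} [CommRing K] [LieRing L] [LieAlgebra K L] [Ring B] [Algebra K B]
  (δ : LieDerivationAction K L B)

theorem mk_one_mul_mk (b c : B) (h : UniversalEnvelopingAlgebra K L) :
    mk δ b 1 * mk δ c h = mk δ (b * c) h := by
  change leftMul δ (b ⊗ₜ 1) (c ⊗ₜ h) = (b * c) ⊗ₜ h
  rw [leftMul_tmul, map_one (diagonal δ)]
  rfl

/-- The inclusion `b ↦ b # 1`. -/
def inl : B →ₐ[K] SmashProduct δ :=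
  AlgHom.ofLinearMap (B := SmashProduct δ)
    ((TensorProduct.mk K B (UniversalEnvelopingAlgebra K L)).flip 1) rfl
    fun b c => (mk_one_mul_mk δ b c 1).symm

/-- The inclusion `h ↦ 1 # h`. -/
def inr : UniversalEnvelopingAlgebra K L →ₐ[K] SmashProduct δ :=
  AlgHom.ofLinearMap (B := SmashProduct δ)
    (TensorProduct.mk K B (UniversalEnvelopingAlgebra K L) 1) rfl fun h k => by
      change _ = leftMul δ (1 ⊗ₜ h) (1 ⊗ₜ k)
      rw [leftMul_tmul, diagonal_one_tmul]
      exact congrArg (· ⊗ₜ[K] (h * k)) (one_mul (1 : B)).symm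

theorem mk_eq_inl_mul_inr (b : B) (h : UniversalEnvelopingAlgebra K L) :
    mk δ b h = inl δ b * inr δ h :=
  (congrArg (mk δ · h) (mul_one b)).symm.trans (mk_one_mul_mk δ b 1 h).symm

theorem inr_ι_mul_inl (x : L) (b : B) :
    inr δ (UniversalEnvelopingAlgebra.ι K x) * inl δ b =
      inl δ (δ.toLieHom x b) + inl δ b * inr δ (UniversalEnvelopingAlgebra.ι K x) := by
  rw [← mk_eq_inl_mul_inr]
  change leftMul δ (1 ⊗ₜ UniversalEnvelopingAlgebra.ι K x) (b ⊗ₜ 1) =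
    δ.toLieHom x b ⊗ₜ 1 + b ⊗ₜ UniversalEnvelopingAlgebra.ι K x
  rw [leftMul_tmul, diagonal_ι, mul_one, map_add, LinearMap.rTensor_tmul, LinearMap.rTensor_tmul,
    LinearMap.mul_apply', LinearMap.mul_apply', one_mul, one_mul]
  rfl

variable {δ}

theorem algHom_ext {E : Type*} [Ring E] [Algebra K E] {f g : SmashProduct δ →ₐ[K] E}
    (hl : ∀ b, f (inl δ b) = g (inl δ b))
    (hr : ∀ x, f (inr δ (UniversalEnvelopingAlgebra.ι K x)) =
      g (inr δ (UniversalEnvelopingAlgebra.ι K x))) : f = g := by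
  have h : f.comp (inr δ) = g.comp (inr δ) := by
    apply UniversalEnvelopingAlgebra.hom_ext
    ext x
    exact hr x
  refine AlgHom.toLinearMap_injective (TensorProduct.ext' fun b k => ?_)
  change f (mk δ b k) = g (mk δ b k)
  rw [mk_eq_inl_mul_inr, map_mul, map_mul, hl]
  exact congrArg _ (DFunLike.congr_fun h k)

variable {E : Type*} [Ring E] [Algebra K E] (f : B →ₐ[K] E) (g : L →ₗ⁅K⁆ E)
    (hfg : ∀ x b, g x * f b = f (δ.toLieHom x b) + f b * g x)

theorem lift_inl (b : B) : lift f g hfg (inl δ b) = f b :=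
  (lift_mk f g hfg b 1).trans (by rw [map_one, mul_one])

theorem lift_inr_ι (x : L) : lift f g hfg (inr δ (UniversalEnvelopingAlgebra.ι K x)) = g x :=
  (lift_mk f g hfg 1 _).trans (by
    rw [map_one, one_mul, UniversalEnvelopingAlgebra.lift_ι_apply])

end SmashProduct

/-! ### Identification of the smash product with a polynomial ring -/

namespace IsPolynomialExtension

theorem commute {K : Type*} [Field K] {T Q : Type u} [Ring T] [Algebra K T] [Ring Q] [Algebra K Q]
    {d : ℕ} {i : T →ₐ[K] Q} {x : Fin d → Q} (h : IsPolynomialExtension i x) (q : Q) (j : Fin d) :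
    Commute q (x j) := by
  induction q using h.induction with
  | map t => exact h.commute_map t j
  | var k => exact h.commute_var k j
  | add p q hp hq => exact hp.add_left hq
  | mul p q hp hq => exact hp.mul_left hq

/-- If `L` is abelian with basis `b` and acts trivially on `B`, then `B # U(L)` is the polynomial
ring over `B` in the elements of `b`. -/
theorem exists_smashProduct_equiv {K B Q : Type u} {L : Type u} [Field K] [LieRing L]
    [LieAlgebra K L] [Ring B] [Algebra K B] [Ring Q] [Algebra K Q]
    {δ : LieDerivationAction K L B} {d : ℕ} (b : Module.Basis (Fin d) K L)
    (hL : ∀ x y : L, ⁅x, y⁆ = 0) (hδ : ∀ x, δ.toLieHom x = 0) {i : B →ₐ[K] Q} {x : Fin d → Q}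
    (h : IsPolynomialExtension i x) :
    ∃ e : SmashProduct δ ≃ₐ[K] Q, (∀ t, e (SmashProduct.inl δ t) = i t) ∧
      ∀ a, e (SmashProduct.inr δ (UniversalEnvelopingAlgebra.ι K a)) = b.constr K x a := by
  have hc (q : Q) (a : L) : Commute q (b.constr K x a) := by
    rw [b.constr_apply_fintype K x]
    exact Commute.sum_right _ _ _ fun j _ => (h.commute q j).smul_right _
  let g : L →ₗ⁅K⁆ Q :=
    { b.constr K x with
      map_lie' := fun {a c} => by
        change b.constr K x ⁅a, c⁆ = ⁅b.constr K x a, b.constr K x c⁆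
        rw [hL, map_zero, LieRing.of_associative_ring_bracket, (hc _ c).eq, sub_self] }
  have hg (a : L) (t : B) : g a * i t = i (δ.toLieHom a t) + i t * g a := by
    rw [hδ, LinearMap.zero_apply, map_zero, zero_add]
    exact (hc (i t) a).eq.symm
  obtain ⟨G, hGi, hGx⟩ := h.exists_lift (S := SmashProduct δ) (SmashProduct.inl δ)
    (fun j => SmashProduct.inr δ (UniversalEnvelopingAlgebra.ι K (b j)))
    (fun j k => by
      have := LieHom.map_lie (UniversalEnvelopingAlgebra.ι K) (b j) (b k)
      rw [hL, map_zero, LieRing.of_associative_ring_bracket] at this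
      exact Commute.map (sub_eq_zero.1 this.symm) (SmashProduct.inr δ))
    (fun t j => by
      have := SmashProduct.inr_ι_mul_inl δ (b j) t
      rw [hδ, LinearMap.zero_apply, map_zero, zero_add] at this
      exact this.symm)
  -- `G` is known only on the variables; linearity in the basis `b` extends this to all of `L`, as
  -- needed for the composite on the smash product.
  have hG : G.toLinearMap ∘ₗ b.constr K x = (SmashProduct.inr δ).toLinearMap ∘ₗ
      (UniversalEnvelopingAlgebra.ι K : L →ₗ⁅K⁆ _).toLinearMap :=
    b.ext fun j => (congrArg G (b.constr_basis K x j)).trans (hGx j)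
  refine ⟨AlgEquiv.ofAlgHom (SmashProduct.lift i g hg) G (h.algHom_ext (fun t => ?_) fun j => ?_)
    (SmashProduct.algHom_ext (fun t => ?_) fun a => ?_), SmashProduct.lift_inl i g hg,
    SmashProduct.lift_inr_ι i g hg⟩
  · exact (congrArg _ (hGi t)).trans (SmashProduct.lift_inl i g hg t)
  · exact (congrArg _ (hGx j)).trans ((SmashProduct.lift_inr_ι i g hg _).trans
      (b.constr_basis K x j))
  · exact (congrArg G (SmashProduct.lift_inl i g hg t)).trans (hGi t)
  · exact (congrArg G (SmashProduct.lift_inr_ι i g hg a)).trans (LinearMap.congr_fun hG a)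

end IsPolynomialExtension

/-! ### Quasi-Poisson cohomology for the trivial bracket -/

theorem yonedaMap_bijective_of_isEquivalence {K C D : Type*} [CommRing K] [Category C] [Abelian C]
    [HasExt.{u} C] [EnoughProjectives C] [Linear K C] [Category D] [Abelian D] [HasExt.{u} D]
    [Linear K D] (F : C ⥤ D) [F.Additive] [F.Linear K] [F.IsEquivalence] (X : C) :
    Function.Bijective (yonedaMap K F X) := by
  have : F.PreservesProjectiveObjects := ⟨fun h => F.asEquivalence.map_projective_iff _ |>.2 h⟩
  exact yonedaMap_bijective K F X (F.mapExt_bijective_of_preservesProjectiveObjects X X)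

namespace PoissonAlgebra

/-- The iterated polynomial ring over `Aᵉ` is carried to `Q(A)` by `e`, and restriction along `e` is
an equivalence of module categories, hence an isomorphism on Yoneda algebras. -/
theorem exists_isExteriorExtension {K A : Type u} [Field K] [Ring A] [Algebra K A]
    [FiniteDimensional K A] [PoissonAlgebra K A] (h : ∀ a b : A, bracket (K := K) a b = 0) :
    ∃ φ, ∃ v : A →ₗ[K] QuasiPoissonCohomology K A,
      IsExteriorExtension (hochschildGrading K A) (quasiPoissonGrading K A) φ v := by
  let b : Module.Basis _ K (LieAlg K A) := Module.finBasis K A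
  have had (x : LieAlg K A) : ad K A x = 0 := LinearMap.ext (h x)
  obtain ⟨Q, _, _, i, x, π, hQ, hi, hx, φ, v, hφ⟩ :=
    exists_isPolynomialExtension (K := K) (regularBimodule K A) (Module.finrank K A)
  obtain ⟨e, hei, hex⟩ := hQ.exists_smashProduct_equiv (δ := envelopingAction K A) b
    (fun a c => h a c) fun x => by
      change (ad K A x).rTensor Aᵐᵒᵖ + (adOp K A x).lTensor A = 0
      rw [adOp, had, map_zero, LinearMap.rTensor_zero, LinearMap.lTensor_zero, add_zero]
  -- Both actions extend that of `Aᵉ`, and both kill the Lie elements: the adjoint action is zero,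
  -- and `π` kills the variables.
  have haction : quasiPoissonAction K A =
      (AlgHom.mulLeftRight K A).comp (π.comp e.toAlgHom) := by
    refine SmashProduct.algHom_ext (fun t => ?_) fun a => ?_
    · refine (SmashProduct.lift_inl _ _ _ t).trans (congrArg _ ?_)
      exact ((congrArg π (hei t)).trans (hi t)).symm
    · refine (SmashProduct.lift_inr_ι _ _ _ a).trans ?_
      have h0 : π (b.constr K x a) = 0 := by
        rw [b.constr_apply_fintype K x, map_sum]
        exact Finset.sum_eq_zero fun j _ => by rw [map_smul, hx, smul_zero]
      exact (had a).trans
        ((congrArg (AlgHom.mulLeftRight K A) ((congrArg π (hex a)).trans h0)).trans (map_zero _)).symm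
  -- Both modules have underlying group `A`, so equality of the actions makes them equal objects,
  -- and the result can be rewritten along this equality.
  have hobj : regularQuasiPoissonModule K A = (ModuleCat.restrictScalars e.toAlgHom.toRingHom).obj
      ((ModuleCat.restrictScalars π.toRingHom).obj (regularBimodule K A)) := by
    rw [regularQuasiPoissonModule, haction]
    rfl
  have : (ModuleCat.restrictScalars.{u} e.toAlgHom.toRingHom).IsEquivalence :=
    ModuleCat.restrictScalars_isEquivalence_of_ringEquiv e.toRingEquiv
  let F := ModuleCat.restrictScalars.{u} e.toAlgHom.toRingHom
  let E := AlgEquiv.ofBijective _ (yonedaMap_bijective_of_isEquivalence (K := K) F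
    ((ModuleCat.restrictScalars π.toRingHom).obj (regularBimodule K A)))
  let l : A ≃ₗ[K] (Fin (Module.finrank K A) → K) := (Module.finBasis K A).equivFun
  have := (hφ.comp_algEquiv E fun n a ha => yonedaMap_mem K F _ ha).comp_linearEquiv l
  change ∃ φ, ∃ v : A →ₗ[K] YonedaAlgebra (regularQuasiPoissonModule K A), IsExteriorExtension
    (hochschildGrading K A) (yonedaGrading K (regularQuasiPoissonModule K A)) φ v
  rw [hobj]
  exact ⟨_, _, this⟩

end PoissonAlgebra

end

theorem mainTheorem8 {K A : Type u} [Field K] [CharZero K] [Ring A] [Algebra K A]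
    [FiniteDimensional K A] [PoissonAlgebra K A]
    (hbracket : ∀ a b : A, PoissonAlgebra.bracket (K := K) a b = 0) :
    ∃ e : QuasiPoissonCohomology K A ≃ₐ[K]
        (hochschildGrading K A ᵍ⊗[K] fun i : ℕ => ⋀[K]^i A),
      ∀ n : ℕ, (quasiPoissonGrading K A n).map e.toLinearMap =
        gradedTensorDegree (hochschildGrading K A) (fun i : ℕ => ⋀[K]^i A) n := by
  obtain ⟨φ, v, h⟩ := PoissonAlgebra.exists_isExteriorExtension hbracket
  exact h.exists_gradedTensorProduct_equiv
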